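/- **Corollary.** Let $q\in\mathbb{C}$ with $0<|q|<1$, fix a fifth root $q^{1/5}$ of $q$ and put $q^{i/5}=(q^{1/5})^i$. Let $(a;q)_d=\prod_{k=0}^{d-1}(1-aq^k)$ for $d\in\mathbb{N}\cup\{\infty\}$ and $(a_1,\dots,a_s;q)_\infty=\prod_i(a_i;q)_\infty$, and let $$\theta_q(Q)=\sum_{d\in\mathbb{Z}}q^{d(d-1)/2}Q^d,\qquad e_{q,\lambda}(Q)=\frac{\theta_q(Q)}{\theta_q(\lambda Q)},\qquad l_q(Q)=-Q\,\frac{\theta_q'(Q)}{\theta_q(Q)}.$$ Let $K=K(\mathbb{P}^3)\otimes\mathbb{C}=\mathbb{C}[P]/\big((1-P)^4\big)$ with $P=\mathcal{O}(-1)$, and $P^{l}=\sum_{k=0}^{3}(-1)^k\binom{l}{k}(1-P)^k$ for $l\in\mathbb{C}$. For $j=1,2,3,4$ let $$W_j(1/Q)=e_{q,q^{j/5}}(1/Q)\sum_{d\ge 0}\frac{(q^{j/5};q)_d^4}{\prod_{i=1}^4(q^{1+(j-i)/5};q)_d}\Big(\frac{q^2}{Q}\Big)^d ,$$ which converges for $|Q|>|q|^2$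 away from the poles of $e_{q,q^{j/5}}(1/Q)$. Then: 1. The $K$-valued series $\sum_{d\ge0}\frac{\prod_{i=1}^4(Pq^{i/5};q)_d}{(Pq;q)_d^4}Q^d$ converges for $|Q|<1$ and continues analytically to $\mathbb{C}^*\setminus q^{\mathbb{Z}}$, and each $W_j(1/Q)$ continues analytically to $\mathbb{C}^*\setminus\big(q^{\mathbb{Z}}\cup -q^{j/5}q^{\mathbb{Z}}\big)$. 2. With these continuations, for all $Q\in\mathbb{C}^*$ outside $q^{\mathbb{Z}}$, $-q^{\mathbb{Z}}$ and $-q^{j/5}q^{\mathbb{Z}}$ ($j=1,\dots,4$), the following identity holds in $K$: $$P^{l_q(Q)}\sum_{d=0}^{\infty}\frac{\prod_{i=1}^{4}(Pq^{i/5};q)_d}{(Pq;q)_d^4}Q^d = P^{l_q(Q)}\frac{\prod_{i=1}^4(Pq^{i/5};q)_\infty}{(Pq;q)_{\infty}^4}\sum_{j=1}^4\frac{\big(q,q,Pq^{j/5}Q,q/(Pq^{j/5}Q);q\big)_\infty}{\big(Pq^{j/5},q/(Pq^{j/5}),Q,q/Q;q\big)_{\infty}}\cdot\frac{\big(q^{1-j/5};q\big)^4_\infty\;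 e_{q,q^{j/5}}(1/Q)^{-1}}{\prod_{i=1,i\neq j}^4\big(q^{(i-j)/5};q\big)_\infty\,(q;q)_\infty}\,W_j(1/Q).$$ -/

import Mathlib

open Polynomial

noncomputable section

namespace QDiff

/-- The ring `K(ℙ³) ⊗ ℂ = ℂ[P] / ((1 - P)⁴)`, where `P` is the class of `𝒪(-1)`. -/
def KP3 : Type := AdjoinRoot ((1 - X : ℂ[X]) ^ 4)

instance : CommRing KP3 := inferInstanceAs (CommRing (AdjoinRoot ((1 - X : ℂ[X]) ^ 4)))

instance : Algebra ℂ KP3 := inferInstanceAs (Algebra ℂ (AdjoinRoot ((1 - X : ℂ[X]) ^ 4)))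

/-- The canonical topology of the finite-dimensional complex vector space `KP3`. -/
instance : TopologicalSpace KP3 := moduleTopology ℂ KP3

instance : IsModuleTopology ℂ KP3 := ⟨rfl⟩

/-- The class `P` of `𝒪(-1)`. -/
def P : KP3 := AdjoinRoot.root ((1 - X : ℂ[X]) ^ 4)

theorem one_sub_P_pow_four : (1 - P) ^ 4 = 0 := by
  have h := AdjoinRoot.mk_self (f := ((1 - X : ℂ[X]) ^ 4))
  simp only [map_pow, map_sub, map_one, AdjoinRoot.mk_X] at h
  exact h

theorem isUnit_P : IsUnit P := by
  have h : IsNilpotent (1 - P) := ⟨4, one_sub_P_pow_four⟩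
  have h2 := h.isUnit_one_sub
  rwa [sub_sub_cancel] at h2

/-- The inverse class `P⁻¹` (recall that `P` is a unit). -/
def Pinv : KP3 := Ring.inverse P

/-- The finite `q`-Pochhammer symbol `(a; q)_d = (1 - a)(1 - q a) ⋯ (1 - q^(d-1) a)`. -/
def qPoch {R : Type*} [CommRing R] [Algebra ℂ R] (a : R) (q : ℂ) (d : ℕ) : R :=
  ∏ k ∈ Finset.range d, (1 - q ^ k • a)

/-- The infinite `q`-Pochhammer symbol `(a; q)_∞ = ∏_{k ≥ 0} (1 - q^k a)`. -/
def qPochInf {R : Type*} [CommRing R] [Algebra ℂ R] [TopologicalSpace R] (a : R) (q : ℂ) : R :=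
  ∏' k : ℕ, (1 - q ^ k • a)

/-- Jacobi's theta function `θ_q(Q) = ∑_{d ∈ ℤ} q^(d(d-1)/2) Q^d`. -/
def theta (q Q : ℂ) : ℂ := ∑' d : ℤ, q ^ (d * (d - 1) / 2) * Q ^ d

/-- The `q`-character `e_{q,lam}(Q) = θ_q(Q) / θ_q(lam Q)`. -/
def qChar (q lam Q : ℂ) : ℂ := theta q Q / theta q (lam * Q)

/-- The `q`-logarithm `ℓ_q(Q) = - Q θ_q'(Q) / θ_q(Q)`. -/
def qLog (q Q : ℂ) : ℂ := -(Q * deriv (theta q) Q / theta q Q)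

/-- The power `P^l = (1 - (1 - P))^l = ∑_k (-1)^k binom(l, k) (1 - P)^k` with a complex exponent;
the terms with `k ≥ 4` vanish because `(1 - P)⁴ = 0`. -/
def Ppow (l : ℂ) : KP3 :=
  ∑ k ∈ Finset.range 4,
    ((-1) ^ k * ((∏ s ∈ Finset.range k, (l - s)) / (k.factorial : ℂ))) • (1 - P) ^ k

/-- `ℂ^*` without the discrete `q`-spiral `c q^ℤ`. -/
def offSpiral (q c : ℂ) : Set ℂ := {Q | Q ≠ 0 ∧ ∀ k : ℤ, Q ≠ c * q ^ k}

/-- The `d`-th term of `∑_d ∏_{i=1}^4 (P q^(i/5); q)_d / (P q; q)_d^4 Q^d`; here `q = r ^ 5`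
and `r ^ i` stands for `q^(i/5)`. -/
def seriesTerm (q r Q : ℂ) (d : ℕ) : KP3 :=
  Q ^ d • ((∏ i ∈ Finset.Icc 1 4, qPoch (r ^ i • P) q d) * Ring.inverse (qPoch (q • P) q d ^ 4))

/-- The `d`-th term of the solution at infinity
`W_j(1/Q) = e_{q,q^(j/5)}(1/Q) · ₄φ₃(a, a, a, a; b₁, b₂, b₃; q; q²/Q)`, where `a = q^(j/5)` and the
lower parameters are `q^(1+(j-i)/5)` for `1 ≤ i ≤ 4`, `i ≠ j`. The factor with `i = j` in the
denominator is the `(q; q)_d` that belongs to the definition of `₄φ₃`. -/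
def solTerm (q r : ℂ) (j : ℕ) (Q : ℂ) (d : ℕ) : ℂ :=
  qChar q (r ^ j) Q⁻¹ *
    (qPoch (r ^ j) q d ^ 4 / (∏ i ∈ Finset.Icc 1 4, qPoch (q * (r ^ j / r ^ i)) q d)
      * (q ^ 2 / Q) ^ d)

end QDiff

end

open QDiff

/-!
Put `A = KP3` and let `f y = (q y; q)_∞^4 / ∏_{i=1}^4 (q^(i/5) y; q)_∞` for `y ∈ A`. Up to the
constant `1 / f P`, the coefficients of the series at `Q = 0` are the values `f (q^d P)`, `d ≥ 0`.
Since `(1 - P)^4 = 0` in `A`, moreover `f (q^d P) = 0` for `d < 0` (`coeffFun_eq_zero`), so the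
series is the bilateral sum of all `f (q^d P) Q^d`. The connection formula is what becomes of this
sum when `f` is replaced by its partial fraction expansion (`qPochInf_quotient_eq_tsum`)
`f y = ∑_j ∑_{m ≥ 0} ρ_{j,m} / (1 - q^(j/5+m) y)`. The residues `ρ_{j,m}` are, up to a factor
depending on `j` only, the coefficients of `W_j`, and after the substitution `n = d + m` the sum
over `d` turns into Kronecker's series `∑_{n ∈ ℤ} Q^n / (1 - q^n a)` with `a = q^(j/5) P`, which is
the theta quotient of the formula (`hasSum_kronecker`). All of this converges for `|q| < |Q| < 1`.

Both expansions are limits of the elementary partial fraction expansion of a quotient of two finite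
products of linear factors (`prod_one_sub_mul_inverse`). That identity, and the dominated passage to
the limit, are valid in any commutative Banach algebra, so they are applied to `P` directly, without
any expansion in powers of `1 - P`.

The coefficients of the series at `0` and at `∞` have the form `g (q^d)` with `g` holomorphic on a
disc of radius greater than one. With Taylor coefficients `δ_n` of `g`, the sum `∑_d g (q^d) Q^d`
equals `∑_n δ_n / (1 - q^n Q)`, which gives the analytic continuation
(`exists_analytic_continuation`). As the complement of a countable set in `ℂ` is connected, the
identity theorem extends the connection formula from the annulus. The zeros of the theta functions
in `e_{q,λ}` are located by Jacobi's triple product identity (`theta_eq_mul`).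
-/


noncomputable section

namespace QDiff

open Filter Topology

/-! ### Dominated limits and `q`-Pochhammer symbols in a Banach algebra -/

section Tannery

/-- Tannery's theorem for sums over finite sets that exhaust the index type: dominated
convergence for series of which the `N`-th approximation has only the terms in `s N`. -/
theorem tendsto_sum_finset_of_dominated {β G : Type*} [NormedAddCommGroup G] [CompleteSpace G]
    {s : ℕ → Finset β} (hs : ∀ b, ∀ᶠ N in atTop, b ∈ s N) {f : ℕ → β → G} {g : β → G}
    {bound : β → ℝ} (hb : Summable bound) (hf : ∀ b, Tendsto (f · b) atTop (𝓝 (g b)))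
    (hle : ∀ N, ∀ b ∈ s N, ‖f N b‖ ≤ bound b) :
    Tendsto (fun N => ∑ b ∈ s N, f N b) atTop (𝓝 (∑' b, g b)) := by
  classical
  have h : ∀ N, ∑ b ∈ s N, f N b = ∑' b, (s N : Set β).indicator (f N) b := fun N =>
    sum_eq_tsum_indicator _ _
  simp_rw [h]
  refine tendsto_tsum_of_dominated_convergence hb (fun b => ?_) (Eventually.of_forall fun N b => ?_)
  · refine (hf b).congr' ?_
    filter_upwards [hs b] with N hN
    rw [Set.indicator_of_mem (by exact_mod_cast hN)]
  · by_cases hN : b ∈ s N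
    · rw [Set.indicator_of_mem (by exact_mod_cast hN)]
      exact hle N b hN
    · rw [Set.indicator_of_notMem (by exact_mod_cast hN), norm_zero]
      obtain ⟨M, hM⟩ := (hs b).exists
      exact (norm_nonneg _).trans (hle M b hM)

theorem exists_norm_le_of_tendsto {G : Type*} [SeminormedAddCommGroup G] {u : ℕ → G} {l : G}
    (h : Tendsto u atTop (𝓝 l)) : ∃ M, 0 ≤ M ∧ ∀ n, ‖u n‖ ≤ M := by
  obtain ⟨M, hM⟩ := h.norm.bddAbove_range
  exact ⟨M, (norm_nonneg _).trans (hM ⟨0, rfl⟩), fun n => hM ⟨n, rfl⟩⟩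

end Tannery

section QPochhammerFinite

variable {R : Type*} [CommRing R] [Algebra ℂ R] {q : ℂ}

@[simp] theorem qPoch_zero (a : R) : qPoch a q 0 = 1 := by simp [qPoch]

theorem qPoch_succ (a : R) (n : ℕ) : qPoch a q (n + 1) = qPoch a q n * (1 - q ^ n • a) :=
  Finset.prod_range_succ _ _

theorem qPoch_add (a : R) (m n : ℕ) :
    qPoch a q (m + n) = qPoch a q m * qPoch (q ^ m • a) q n := by
  simp only [qPoch, Finset.prod_range_add, smul_smul, pow_add, mul_comm]

theorem isUnit_qPoch {a : R} (ha : ∀ k : ℕ, IsUnit (1 - q ^ k • a)) (n : ℕ) :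
    IsUnit (qPoch a q n) :=
  IsUnit.prod_iff.2 fun k _ => ha k

end QPochhammerFinite

section QPochhammerInfinite

theorem tendsto_ringInverse {A : Type*} [NormedCommRing A] [CompleteSpace A] {u : ℕ → A} {l : A}
    (hl : IsUnit l) (h : Tendsto u atTop (𝓝 l)) :
    Tendsto (fun n => Ring.inverse (u n)) atTop (𝓝 (Ring.inverse l)) := by
  obtain ⟨l, rfl⟩ := hl
  exact (NormedRing.inverse_continuousAt l).tendsto.comp h

variable {A : Type*} [NormedCommRing A] [NormedAlgebra ℂ A] {q : ℂ}

theorem summable_norm_pow_smul (hq : ‖q‖ < 1) (a : A) : Summable fun k : ℕ => ‖q ^ k • a‖ := by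
  simp_rw [norm_smul, norm_pow]
  exact (summable_geometric_of_lt_one (norm_nonneg _) hq).mul_right _

theorem tendsto_one_sub_pow_smul (hq : ‖q‖ < 1) (a : A) :
    Tendsto (fun k : ℕ => 1 - q ^ k • a) atTop (𝓝 1) := by
  simpa using ((tendsto_pow_atTop_nhds_zero_of_norm_lt_one hq).smul_const a).const_sub 1

theorem tendsto_ringInverse_one_sub_pow_smul [CompleteSpace A] (hq : ‖q‖ < 1) (a : A) :
    Tendsto (fun k : ℕ => Ring.inverse (1 - q ^ k • a)) atTop (𝓝 1) := by
  simpa using tendsto_ringInverse isUnit_one (tendsto_one_sub_pow_smul hq a)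

variable [NormOneClass A]

theorem norm_qPoch_le (hq : ‖q‖ < 1) (a : A) (n : ℕ) :
    ‖qPoch a q n‖ ≤ Real.exp (‖a‖ / (1 - ‖q‖)) := by
  have h1 : ‖qPoch a q n‖ ≤ ∏ k ∈ Finset.range n, Real.exp (‖q‖ ^ k * ‖a‖) := by
    refine (Finset.norm_prod_le _ _).trans (Finset.prod_le_prod (fun _ _ => norm_nonneg _)
      fun k _ => (norm_sub_le _ _).trans ?_)
    rw [norm_one, norm_smul, norm_pow, add_comm]
    exact Real.add_one_le_exp _
  refine h1.trans ?_
  rw [← Real.exp_sum, Real.exp_le_exp, ← Finset.sum_mul, div_eq_inv_mul]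
  gcongr
  rw [← tsum_geometric_of_lt_one (norm_nonneg _) hq]
  exact (summable_geometric_of_lt_one (norm_nonneg _) hq).sum_le_tsum _ fun _ _ => by positivity

variable [CompleteSpace A]

theorem multipliable_one_sub_pow_smul (hq : ‖q‖ < 1) (a : A) :
    Multipliable fun k : ℕ => 1 - q ^ k • a := by
  simp_rw [sub_eq_add_neg]
  exact multipliable_one_add_of_summable (by simpa using summable_norm_pow_smul hq a)

theorem tendsto_qPoch (hq : ‖q‖ < 1) (a : A) :
    Tendsto (fun n => qPoch a q n) atTop (𝓝 (qPochInf a q)) :=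
  (multipliable_one_sub_pow_smul hq a).tendsto_prod_tprod_nat

theorem qPochInf_eq_qPoch_mul (hq : ‖q‖ < 1) (a : A) (n : ℕ) :
    qPochInf a q = qPoch a q n * qPochInf (q ^ n • a) q := by
  refine tendsto_nhds_unique ((tendsto_add_atTop_iff_nat n).2 (tendsto_qPoch hq a)) ?_
  simp_rw [add_comm _ n, qPoch_add]
  exact (tendsto_qPoch hq _).const_mul _

theorem isUnit_qPochInf (hq : ‖q‖ < 1) {a : A} (ha : ∀ k : ℕ, IsUnit (1 - q ^ k • a)) :
    IsUnit (qPochInf a q) := by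
  -- the reciprocals `1 / (1 - q ^ k a) = 1 + q ^ k a / (1 - q ^ k a)` are multipliable as well
  set w : ℕ → A := fun k => q ^ k • (a * Ring.inverse (1 - q ^ k • a)) with hw
  obtain ⟨M, hM0, hM⟩ := exists_norm_le_of_tendsto (tendsto_ringInverse_one_sub_pow_smul hq a)
  have hmul : Multipliable fun k => 1 + w k := by
    refine multipliable_one_add_of_summable
      (((summable_geometric_of_lt_one (norm_nonneg _) hq).mul_right (‖a‖ * M)).of_nonneg_of_le
        (fun _ => norm_nonneg _) fun k => ?_)
    rw [hw, norm_smul, norm_pow]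
    gcongr
    exact (norm_mul_le _ _).trans (by gcongr; exact hM k)
  have h1 : ∀ k, (1 - q ^ k • a) * (1 + w k) = 1 := fun k => by
    have := Ring.mul_inverse_cancel _ (ha k)
    have h2 : w k = q ^ k • a * Ring.inverse (1 - q ^ k • a) := by simp [hw]
    rw [h2]
    linear_combination q ^ k • a * this
  refine IsUnit.of_mul_eq_one (∏' k, (1 + w k)) ?_
  rw [qPochInf, ← (multipliable_one_sub_pow_smul hq a).tprod_mul hmul]
  simp [h1]

/-- The telescoping series `(a; q)_n - (a; q)_{n+1} = q^n a (a; q)_n`. -/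
theorem hasSum_qPochInf (hq : ‖q‖ < 1) (a : A) :
    HasSum (fun n : ℕ => q ^ n • (a * qPoch a q n)) (1 - qPochInf a q) := by
  have hs : Summable fun n : ℕ => q ^ n • (a * qPoch a q n) := by
    obtain ⟨M, hM0, hM⟩ := exists_norm_le_of_tendsto (tendsto_qPoch hq a)
    refine Summable.of_norm_bounded
      ((summable_geometric_of_lt_one (norm_nonneg _) hq).mul_right (‖a‖ * M)) fun k => ?_
    rw [norm_smul, norm_pow]
    gcongr
    exact (norm_mul_le _ _).trans (by gcongr; exact hM k)
  rw [hs.hasSum_iff_tendsto_nat]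
  refine ((tendsto_qPoch hq a).const_sub 1).congr fun n => ?_
  induction n with
  | zero => simp
  | succ n ih =>
    rw [Finset.sum_range_succ, ← ih, qPoch_succ, mul_sub, mul_one, mul_smul_comm, mul_comm a]
    ring

theorem differentiable_qPochInf_smul (hq : ‖q‖ < 1) (a : A) :
    Differentiable ℂ fun x : ℂ => qPochInf (x • a) q := by
  intro x₀
  set B : ℝ := (‖x₀‖ + 1) * ‖a‖
  have key : DifferentiableOn ℂ (fun x : ℂ => ∑' n : ℕ, q ^ n • (x • a * qPoch (x • a) q n))
      (Metric.ball 0 (‖x₀‖ + 1)) := by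
    refine Complex.differentiableOn_tsum_of_summable_norm
      ((summable_geometric_of_lt_one (norm_nonneg _) hq).mul_right
        (B * Real.exp (B / (1 - ‖q‖)))) (fun n => ?_) Metric.isOpen_ball
        fun n x hx => ?_
    · refine Differentiable.differentiableOn ?_
      unfold qPoch
      fun_prop
    · have hB : ‖x • a‖ ≤ B := by
        rw [norm_smul]
        exact mul_le_mul_of_nonneg_right (mem_ball_zero_iff.1 hx).le (norm_nonneg _)
      rw [norm_smul, norm_pow]
      refine mul_le_mul_of_nonneg_left ((norm_mul_le _ _).trans ?_) (by positivity)
      have h1 : 0 < 1 - ‖q‖ := by linarith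
      refine mul_le_mul hB ((norm_qPoch_le hq _ n).trans ?_) (norm_nonneg _)
        ((norm_nonneg _).trans hB)
      exact Real.exp_le_exp.2 (div_le_div_of_nonneg_right hB h1.le)
  have h2 : (fun x : ℂ => qPochInf (x • a) q) =
      fun x => 1 - ∑' n : ℕ, q ^ n • (x • a * qPoch (x • a) q n) := by
    ext x
    rw [(hasSum_qPochInf hq _).tsum_eq]
    ring
  rw [h2]
  exact ((key.differentiableAt (Metric.isOpen_ball.mem_nhds (by simp))).const_sub _)

end QPochhammerInfinite

/-! ### Partial fractions of finite products -/

open Finset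

section PartialFractions

/-- Partial fractions for a quotient of two products of the same number of linear factors,
with simple poles. -/
theorem prod_one_sub_mul_inverse {ι R : Type*} [DecidableEq ι] [CommRing R] [Algebra ℂ R]
    {s : Finset ι} {c : ι → ℂ} (d : ι → ℂ) (hc0 : ∀ i ∈ s, c i ≠ 0) (hc : Set.InjOn c s) {y : R}
    (hy : ∀ i ∈ s, IsUnit (1 - c i • y)) :
    (∏ i ∈ s, (1 - d i • y)) * Ring.inverse (∏ i ∈ s, (1 - c i • y)) =
      algebraMap ℂ R (∏ i ∈ s, d i / c i) +
        ∑ i ∈ s, ((∏ t ∈ s, (1 - d t / c i)) / ∏ t ∈ s.erase i, (1 - c t / c i)) •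
          Ring.inverse (1 - c i • y) := by
  -- Lagrange interpolation at the points `1 / c i` of the difference of the numerator and the
  -- multiple of the denominator that has the same leading coefficient
  set N : ℂ[X] := ∏ i ∈ s, (1 - C (d i) * X) with hN
  set M : ℂ[X] := ∏ i ∈ s, (1 - C (c i) * X) with hM
  set K : ℂ := ∏ i ∈ s, d i / c i with hK
  have hdeg1 : ∀ e : ℂ, (1 - C e * X : ℂ[X]).natDegree ≤ 1 := fun e => by compute_degree
  have hdeg : ∀ e : ι → ℂ, (∏ i ∈ s, (1 - C (e i) * X : ℂ[X])).natDegree ≤ #s := fun e =>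
    (natDegree_prod_le _ _).trans
      ((Finset.sum_le_card_nsmul _ _ 1 fun i _ => hdeg1 _).trans (by simp))
  have hcoeff : ∀ e : ι → ℂ, (∏ i ∈ s, (1 - C (e i) * X : ℂ[X])).coeff #s = ∏ i ∈ s, (- e i) :=
    fun e => by
      have := coeff_prod_of_natDegree_le (s := s) (fun i => (1 - C (e i) * X : ℂ[X])) 1
        fun i _ => hdeg1 _
      rw [mul_one] at this
      rw [this]
      simp [coeff_one]
  have hlt : (N - C K * M).degree < #s := by
    rw [degree_lt_iff_coeff_zero]
    intro m hm
    rw [coeff_sub, coeff_C_mul]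
    rcases hm.eq_or_lt with rfl | hm
    · rw [hN, hM, hcoeff, hcoeff, hK, ← Finset.prod_mul_distrib, sub_eq_zero]
      refine Finset.prod_congr rfl fun i hi => ?_
      field_simp [hc0 i hi]
    · rw [coeff_eq_zero_of_natDegree_lt ((hdeg d).trans_lt hm),
        coeff_eq_zero_of_natDegree_lt ((hdeg c).trans_lt hm)]
      simp
  have hinj : Set.InjOn (fun i => (c i)⁻¹) s := fun i hi j hj h => hc hi hj (inv_injective h)
  have hint := Lagrange.eq_interpolate hinj hlt
  have hval : ∀ i ∈ s, eval (c i)⁻¹ (N - C K * M) = ∏ t ∈ s, (1 - d t / c i) := by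
    intro i hi
    have h0 : eval (c i)⁻¹ M = 0 := by
      rw [hM, eval_prod]
      exact Finset.prod_eq_zero hi (by simp [hc0 i hi])
    rw [eval_sub, eval_mul, h0, mul_zero, sub_zero, hN, eval_prod]
    simp [div_eq_mul_inv]
  have hbasis : ∀ i ∈ s, Lagrange.basis s (fun i => (c i)⁻¹) i =
      C (∏ t ∈ s.erase i, (1 - c t / c i))⁻¹ * ∏ t ∈ s.erase i, (1 - C (c t) * X) := by
    intro i hi
    rw [Lagrange.basis, ← Finset.prod_inv_distrib, map_prod, ← Finset.prod_mul_distrib]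
    refine Finset.prod_congr rfl fun t ht => ?_
    have hti := Finset.mem_erase.1 ht
    have h1 := hc0 i hi
    have h2 := hc0 t hti.2
    have h3 : c t ≠ c i := fun h => hti.1 (hc hti.2 hi h)
    have h4 : c i - c t ≠ 0 := sub_ne_zero.2 h3.symm
    have h5 : (1 - c t / c i)⁻¹ = -((c i)⁻¹ - (c t)⁻¹)⁻¹ * (c t)⁻¹ := by
      have h6 : 1 - c t / c i ≠ 0 := by
        rw [sub_ne_zero]; intro h; rw [eq_div_iff h1, one_mul] at h; exact h3 h.symm
      have h7 : (c i)⁻¹ - (c t)⁻¹ ≠ 0 := sub_ne_zero.2 fun h => h3 (inv_injective h).symm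
      field_simp
      ring
    have h8 : (C (c t)⁻¹ * C (c t) : ℂ[X]) = 1 := by rw [← C_mul, inv_mul_cancel₀ h2, C_1]
    rw [Lagrange.basisDivisor, h5, C_mul, C_neg]
    linear_combination (-C ((c i)⁻¹ - (c t)⁻¹)⁻¹ * X) * h8
  have haeval : ∀ e : ι → ℂ, ∀ u : Finset ι,
      aeval y (∏ i ∈ u, (1 - C (e i) * X : ℂ[X])) = ∏ i ∈ u, (1 - e i • y) := fun e u => by
    simp [map_prod, Algebra.smul_def]
  have hunit : IsUnit (∏ i ∈ s, (1 - c i • y)) := IsUnit.prod_iff.2 hy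
  have h9 : N = C K * M + ∑ i ∈ s, C (∏ t ∈ s, (1 - d t / c i)) *
      (C (∏ t ∈ s.erase i, (1 - c t / c i))⁻¹ * ∏ t ∈ s.erase i, (1 - C (c t) * X)) := by
    rw [← sub_eq_iff_eq_add', hint, Lagrange.interpolate_apply]
    refine Finset.sum_congr rfl fun i hi => ?_
    rw [hval i hi, hbasis i hi]
  have h10 := congrArg (aeval y) h9
  simp only [map_add, map_mul, map_sum, aeval_C, hN, hM, haeval] at h10
  rw [h10, add_mul, mul_assoc, Ring.mul_inverse_cancel _ hunit, mul_one, Finset.sum_mul]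
  congr 1
  refine Finset.sum_congr rfl fun i hi => ?_
  have h11 : (∏ t ∈ s.erase i, (1 - c t • y)) * Ring.inverse (∏ i ∈ s, (1 - c i • y)) =
      Ring.inverse (1 - c i • y) := by
    rw [← (hy i hi).mul_right_inj, Ring.mul_inverse_cancel _ (hy i hi), ← mul_assoc,
      Finset.mul_prod_erase s (fun t => 1 - c t • y) hi, Ring.mul_inverse_cancel _ hunit]
  rw [mul_assoc, mul_assoc, h11, ← mul_assoc, ← map_mul, ← div_eq_mul_inv, ← Algebra.smul_def]

/-- The scalar `∏_{l=1}^m (-1/q^l)` by which the `m` factors of `(q^(-m) u; q)_m` are reflected. -/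
def reflectFactor (q : ℂ) (m : ℕ) : ℂ := ∏ l ∈ Finset.range m, (-1 / q ^ (l + 1))

theorem reflectFactor_ne_zero {q : ℂ} (hq : q ≠ 0) (m : ℕ) : reflectFactor q m ≠ 0 :=
  Finset.prod_ne_zero_iff.2 fun l _ => div_ne_zero (by norm_num) (pow_ne_zero _ hq)

/-- Reversal of the factors of `(q^(-m) u; q)_m`, where `v = u⁻¹`. -/
theorem qPoch_inv_pow_smul {R : Type*} [CommRing R] [Algebra ℂ R] {q : ℂ} (hq : q ≠ 0) {u v : R}
    (huv : u * v = 1) (m : ℕ) :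
    qPoch ((q ^ m)⁻¹ • u) q m = reflectFactor q m • (u ^ m * qPoch (q • v) q m) := by
  unfold qPoch reflectFactor
  rw [← Finset.prod_range_reflect]
  have : ∀ k ∈ Finset.range m, 1 - q ^ (m - 1 - k) • (q ^ m)⁻¹ • u =
      (-1 / q ^ (k + 1)) • (u * (1 - q ^ k • q • v)) := by
    intro k hk
    have hk := Finset.mem_range.1 hk
    have h1 : q ^ (m - 1 - k) * (q ^ m)⁻¹ = (q ^ (k + 1))⁻¹ := by
      rw [← div_eq_mul_inv, div_eq_iff (pow_ne_zero _ hq), inv_mul_eq_div,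
        eq_div_iff (pow_ne_zero _ hq), ← pow_add]
      congr 1; omega
    rw [smul_smul, h1, smul_smul, ← pow_succ, mul_sub, mul_one, mul_smul_comm, huv, smul_sub,
      smul_smul, div_mul_cancel₀ _ (pow_ne_zero _ hq), neg_smul, one_smul, sub_neg_eq_add, neg_div,
      neg_smul, one_div]
    ring
  rw [Finset.prod_congr rfl this, Finset.prod_smul, Finset.prod_mul_distrib,
    Finset.prod_const, Finset.card_range]

theorem qPoch_inv_pow_smul_add {R : Type*} [CommRing R] [Algebra ℂ R] {q : ℂ} (hq : q ≠ 0)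
    {u v : R} (huv : u * v = 1) (m n : ℕ) :
    qPoch ((q ^ m)⁻¹ • u) q (m + n) =
      reflectFactor q m • (u ^ m * qPoch (q • v) q m) * qPoch u q n := by
  rw [qPoch_add, qPoch_inv_pow_smul hq huv, smul_smul, mul_inv_cancel₀ (pow_ne_zero _ hq), one_smul]

theorem prod_erase_product {α β M : Type*} [DecidableEq α] [DecidableEq β] [CommMonoid M]
    {s : Finset α} {t : Finset β} {a : α} {b : β} (ha : a ∈ s) (f : α × β → M) :
    ∏ x ∈ (s ×ˢ t).erase (a, b), f x =
      (∏ i ∈ s.erase a, ∏ k ∈ t, f (i, k)) * ∏ k ∈ t.erase b, f (a, k) := by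
  have h : (s ×ˢ t).erase (a, b) = s.erase a ×ˢ t ∪ {a} ×ˢ t.erase b := by
    ext ⟨x, y⟩
    simp only [mem_erase, mem_product, mem_union, mem_singleton, ne_eq, Prod.mk.injEq]
    constructor
    · rintro ⟨h1, h2, h3⟩
      by_cases hx : x = a
      · exact Or.inr ⟨hx, fun hy => h1 ⟨hx, hy⟩, h3⟩
      · exact Or.inl ⟨⟨hx, h2⟩, h3⟩
    · rintro (⟨⟨h1, h2⟩, h3⟩ | ⟨rfl, h2, h3⟩)
      · exact ⟨fun h => h1 h.1, h2, h3⟩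
      · exact ⟨fun h => h2 h.2, ha, h3⟩
  rw [h, prod_union, prod_product, prod_product, prod_singleton]
  rw [disjoint_left]
  rintro ⟨x, y⟩ h1 h2
  simp only [mem_erase, mem_product, mem_singleton] at h1 h2
  exact h1.1.1 h2.1

theorem prod_range_erase {M : Type*} [CommMonoid M] (f : ℕ → M) (m n : ℕ) :
    ∏ k ∈ (range (m + (n + 1))).erase m, f k =
      (∏ k ∈ range m, f k) * ∏ k ∈ range n, f (m + (k + 1)) := by
  induction n with
  | zero => simp [range_add_one]
  | succ n ih =>
    rw [← add_assoc m (n + 1) 1, range_add_one, erase_insert_of_ne (by omega),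
      prod_insert (by simp), ih, prod_range_succ]
    exact mul_left_comm _ _ _ |>.trans (congrArg _ (mul_comm _ _))

/-- The product that remains of `(q^(-m); q)_{m+n+1}` when its vanishing factor is left out. -/
theorem prod_erase_one_sub_div {q : ℂ} (hq : q ≠ 0) (m n : ℕ) :
    ∏ k ∈ (range (m + (n + 1))).erase m, (1 - q ^ k / q ^ m) =
      reflectFactor q m * qPoch q q m * qPoch q q n := by
  rw [prod_range_erase]
  congr 1
  · have := qPoch_inv_pow_smul hq (mul_one (1 : ℂ)) m
    simp only [smul_eq_mul, mul_one, one_pow, one_mul] at this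
    rw [← this]
    exact prod_congr rfl fun k _ => by rw [smul_eq_mul, div_eq_mul_inv]
  · refine prod_congr rfl fun k _ => ?_
    rw [pow_add, mul_div_cancel_left₀ _ (pow_ne_zero _ hq), pow_succ, smul_eq_mul]

end PartialFractions

/-! ### The residues of the coefficient function -/

section Residues

variable {q r : ℂ}

theorem pow_ne_pow (hr0 : r ≠ 0) (hr1 : ‖r‖ < 1) {a b : ℕ} (hab : a ≠ b) : r ^ a ≠ r ^ b := by
  intro h
  have h2 := congrArg norm h
  rw [norm_pow, norm_pow] at h2
  exact hab (pow_right_injective₀ (norm_pos_iff.2 hr0) hr1.ne h2)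

theorem one_sub_pow_smul_div_ne_zero (hr0 : r ≠ 0) (hr1 : ‖r‖ < 1) (hr : r ^ 5 = q) {i j : ℕ}
    (k : ℕ) (h : 5 * k + i ≠ j) : 1 - q ^ k • (r ^ i / r ^ j) ≠ 0 := by
  rw [sub_ne_zero, smul_eq_mul, ← hr, ← pow_mul, ← mul_div_assoc, ← pow_add]
  intro h1
  rw [eq_div_iff (pow_ne_zero _ hr0), one_mul] at h1
  exact pow_ne_pow hr0 hr1 h h1.symm

/-- The coefficients `(a, a, a, a; q)_m / (b₁, b₂, b₃, q; q)_m` of the basic hypergeometric series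
`₄φ₃` at infinity that belongs to the exponent `a = q^(j/5)`. -/
def hgCoeff (q r : ℂ) (j m : ℕ) : ℂ :=
  qPoch (r ^ j) q m ^ 4 / ∏ i ∈ Icc 1 4, qPoch (q * (r ^ j / r ^ i)) q m

/-- The scalar connection coefficient `(q^(1-j/5); q)_∞^4 / (∏_{i ≠ j} (q^((i-j)/5); q)_∞ (q; q)_∞)`
of the solution with index `j`. -/
def connConst (q r : ℂ) (j : ℕ) : ℂ :=
  qPochInf (q / r ^ j) q ^ 4 /
    ((∏ i ∈ (Icc 1 4).erase j, qPochInf (r ^ i / r ^ j) q) * qPochInf q q)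

/-- The approximation of `connConst` by finite products. -/
def connConstApprox (q r : ℂ) (j n : ℕ) : ℂ :=
  qPoch (q / r ^ j) q (n + 1) ^ 4 /
    ((∏ i ∈ (Icc 1 4).erase j, qPoch (r ^ i / r ^ j) q (n + 1)) * qPoch q q n)

theorem isUnit_one_sub_lower (hr0 : r ≠ 0) (hr1 : ‖r‖ < 1) (hr : r ^ 5 = q) {i j : ℕ}
    (hi : i ∈ Icc 1 4) (k : ℕ) :
    IsUnit (1 - q ^ k • (q * (r ^ j / r ^ i))) := by
  rw [mem_Icc] at hi
  have := one_sub_pow_smul_div_ne_zero hr0 hr1 hr (i := j) (j := i) (k + 1) (by omega)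
  rw [isUnit_iff_ne_zero]
  convert this using 2
  simp only [smul_eq_mul]
  ring

theorem isUnit_one_sub_upper (hr0 : r ≠ 0) (hr1 : ‖r‖ < 1) (hr : r ^ 5 = q) {i j : ℕ}
    (hi : i ∈ Icc 1 4) (hj : j ∈ Icc 1 4) (hij : i ≠ j) (k : ℕ) :
    IsUnit (1 - q ^ k • (r ^ i / r ^ j)) := by
  rw [mem_Icc] at hi hj
  exact isUnit_iff_ne_zero.2 (one_sub_pow_smul_div_ne_zero hr0 hr1 hr k (by omega))

theorem isUnit_one_sub_self (hr0 : r ≠ 0) (hr1 : ‖r‖ < 1) (hr : r ^ 5 = q) (k : ℕ) :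
    IsUnit (1 - q ^ k • q) := by
  have := one_sub_pow_smul_div_ne_zero hr0 hr1 hr (i := 5) (j := 0) k (by omega)
  rw [isUnit_iff_ne_zero]
  rwa [pow_zero, div_one, hr] at this

theorem tendsto_hgCoeff (hr0 : r ≠ 0) (hr1 : ‖r‖ < 1) (hq1 : ‖q‖ < 1) (hr : r ^ 5 = q) (j : ℕ) :
    Tendsto (hgCoeff q r j) atTop (𝓝 (qPochInf (r ^ j) q ^ 4 /
      ∏ i ∈ Icc 1 4, qPochInf (q * (r ^ j / r ^ i)) q)) := by
  refine ((tendsto_qPoch hq1 _).pow 4).div (tendsto_finsetProd _ fun i _ => tendsto_qPoch hq1 _) ?_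
  exact prod_ne_zero_iff.2 fun i hi =>
    (isUnit_qPochInf hq1 (isUnit_one_sub_lower hr0 hr1 hr hi)).ne_zero

theorem tendsto_connConstApprox (hr0 : r ≠ 0) (hr1 : ‖r‖ < 1) (hq1 : ‖q‖ < 1) (hr : r ^ 5 = q)
    {j : ℕ} (hj : j ∈ Icc 1 4) :
    Tendsto (connConstApprox q r j) atTop (𝓝 (connConst q r j)) := by
  have h : ∀ a : ℂ, Tendsto (fun n => qPoch a q (n + 1)) atTop (𝓝 (qPochInf a q)) := fun a =>
    (tendsto_add_atTop_iff_nat 1).2 (tendsto_qPoch hq1 a)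
  refine ((h _).pow 4).div ((tendsto_finsetProd _ fun i _ => h _).mul (tendsto_qPoch hq1 _)) ?_
  refine mul_ne_zero (prod_ne_zero_iff.2 fun i hi => ?_)
    (isUnit_qPochInf hq1 (isUnit_one_sub_self hr0 hr1 hr)).ne_zero
  rw [mem_erase] at hi
  exact (isUnit_qPochInf hq1 (isUnit_one_sub_upper hr0 hr1 hr hi.2 hj hi.1)).ne_zero

/-- The coefficient of `1 / (1 - q^(j/5+m) y)` in the expansion of the finite quotient
`∏_{k ≤ m+n} (1 - q^(k+1) y)^4 / ∏_{k ≤ m+n} ∏_i (1 - q^(i/5+k) y)`. The factor `q^(2m)`, which makes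
the limit of the expansions converge, is `(q^4 / ∏_i q^(i/5))^m`. -/
theorem residue_eq (hr0 : r ≠ 0) (hr : r ^ 5 = q) {j : ℕ} (hj : j ∈ Icc 1 4)
    (m n : ℕ) :
    (∏ t ∈ Icc 1 4 ×ˢ range (m + n + 1), (1 - q ^ (t.2 + 1) / (r ^ j * q ^ m))) /
      ∏ t ∈ (Icc 1 4 ×ˢ range (m + n + 1)).erase (j, m),
        (1 - r ^ t.1 * q ^ t.2 / (r ^ j * q ^ m)) =
      q ^ (2 * m) * hgCoeff q r j m * connConstApprox q r j n := by
  have hq0 : q ≠ 0 := hr ▸ pow_ne_zero 5 hr0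
  have hrj := pow_ne_zero j hr0
  have h1 : ∏ k ∈ range (m + n + 1), (1 - q ^ (k + 1) / (r ^ j * q ^ m)) =
      reflectFactor q m * ((q / r ^ j) ^ m * qPoch (r ^ j) q m) * qPoch (q / r ^ j) q (n + 1) := by
    have := qPoch_inv_pow_smul_add hq0 (u := q / r ^ j) (v := r ^ j / q) (by field_simp) m (n + 1)
    simp only [smul_eq_mul] at this
    rw [mul_div_cancel₀ _ hq0] at this
    rw [← this]
    refine prod_congr rfl fun k _ => ?_
    rw [smul_eq_mul, pow_succ]
    field_simp
  have h2 : ∀ i, ∏ k ∈ range (m + n + 1), (1 - r ^ i * q ^ k / (r ^ j * q ^ m)) =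
      reflectFactor q m * ((r ^ i / r ^ j) ^ m * qPoch (q * (r ^ j / r ^ i)) q m) *
        qPoch (r ^ i / r ^ j) q (n + 1) := fun i => by
    have hri := pow_ne_zero i hr0
    have := qPoch_inv_pow_smul_add hq0 (u := r ^ i / r ^ j) (v := r ^ j / r ^ i) (by field_simp)
      m (n + 1)
    simp only [smul_eq_mul] at this
    rw [← this]
    refine prod_congr rfl fun k _ => ?_
    rw [smul_eq_mul]
    field_simp
  have h3 : ∏ k ∈ (range (m + n + 1)).erase m, (1 - r ^ j * q ^ k / (r ^ j * q ^ m)) =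
      reflectFactor q m * qPoch (q * (r ^ j / r ^ j)) q m * qPoch q q n := by
    rw [div_self hrj, mul_one, ← prod_erase_one_sub_div hq0]
    exact prod_congr rfl fun k _ => by rw [mul_div_mul_left _ _ hrj]
  have hcard : #((Icc 1 4).erase j) = 3 := by rw [card_erase_of_mem hj]; simp
  have hpow : (∏ i ∈ (Icc 1 4).erase j, (r ^ i / r ^ j)) * q ^ 2 = (q / r ^ j) ^ 4 := by
    have := mul_prod_erase (Icc 1 4) (fun i => r ^ i / r ^ j) hj
    rw [div_self hrj, one_mul] at this
    rw [this, ← hr]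
    simp only [prod_div_distrib, prod_const, Nat.card_Icc]
    have h4 : ∏ i ∈ Icc 1 4, r ^ i = r ^ 10 := by
      rw [prod_pow_eq_pow_sum]; rfl
    rw [h4]
    field_simp
    
  have hcard : #((Icc 1 4).erase j) = 3 := by rw [card_erase_of_mem hj]; simp
  set ρ := ∏ i ∈ (Icc 1 4).erase j, r ^ i / r ^ j with hρ_def
  have hρ : ρ ^ m ≠ 0 := pow_ne_zero _ (prod_ne_zero_iff.2 fun i _ =>
    div_ne_zero (pow_ne_zero _ hr0) hrj)
  have hκ := pow_ne_zero 4 (reflectFactor_ne_zero hq0 m)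
  have hx : ((q / r ^ j) ^ m) ^ 4 = ρ ^ m * q ^ (2 * m) := by
    rw [← pow_mul, mul_comm m 4, pow_mul, ← hpow, mul_pow, pow_mul]
  have hnum : ∏ t ∈ Icc 1 4 ×ˢ range (m + n + 1), (1 - q ^ (t.2 + 1) / (r ^ j * q ^ m)) =
      reflectFactor q m ^ 4 * ρ ^ m *
        (q ^ (2 * m) * (qPoch (r ^ j) q m ^ 4 * qPoch (q / r ^ j) q (n + 1) ^ 4)) := by
    rw [prod_product]
    simp only [h1, prod_const, Nat.card_Icc]
    linear_combination (reflectFactor q m ^ 4 * (qPoch (r ^ j) q m ^ 4 *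
      qPoch (q / r ^ j) q (n + 1) ^ 4)) * hx
  have hden : ∏ t ∈ (Icc 1 4 ×ˢ range (m + n + 1)).erase (j, m),
        (1 - r ^ t.1 * q ^ t.2 / (r ^ j * q ^ m)) =
      reflectFactor q m ^ 4 * ρ ^ m * ((∏ i ∈ Icc 1 4, qPoch (q * (r ^ j / r ^ i)) q m) *
        ((∏ i ∈ (Icc 1 4).erase j, qPoch (r ^ i / r ^ j) q (n + 1)) * qPoch q q n)) := by
    rw [prod_erase_product hj, ← mul_prod_erase _ _ hj]
    simp only [h2, h3, prod_mul_distrib, prod_const, hcard, prod_pow]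
    rw [← hρ_def]
    ring
  rw [hnum, hden, mul_div_mul_left _ _ (mul_ne_zero hκ hρ), hgCoeff, connConstApprox, mul_assoc,
    div_mul_div_comm, mul_div_assoc]

end Residues

/-! ### The partial fraction expansion of the coefficient function -/

section PartialFractionExpansion

variable {A : Type*} [NormedCommRing A] [NormedAlgebra ℂ A] [NormOneClass A] [CompleteSpace A]
variable {q r : ℂ}

theorem summable_hgCoeff_mul (hr0 : r ≠ 0) (hr1 : ‖r‖ < 1) (hq1 : ‖q‖ < 1) (hr : r ^ 5 = q) (j : ℕ)
    {z : ℂ} (hz : ‖z‖ < 1) : Summable fun m => ‖z ^ m * hgCoeff q r j m‖ := by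
  obtain ⟨M, hM0, hM⟩ := exists_norm_le_of_tendsto (tendsto_hgCoeff hr0 hr1 hq1 hr j)
  refine ((summable_geometric_of_lt_one (norm_nonneg _) hz).mul_right M).of_nonneg_of_le
    (fun _ => norm_nonneg _) fun m => ?_
  rw [norm_mul, norm_pow]
  gcongr
  exact hM m

/-- The partial fraction expansion of `(q y; q)_∞^4 / ∏_{i=1}^4 (q^(i/5) y; q)_∞`. It is the limit
of the expansions of the quotients of finite products, whose value at `y = ∞` tends to `0`. -/
theorem qPochInf_quotient_eq_tsum (hr0 : r ≠ 0) (hr1 : ‖r‖ < 1) (hq1 : ‖q‖ < 1) (hr : r ^ 5 = q)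
    {y : A} (hy : ∀ j ∈ Icc 1 4, ∀ m, IsUnit (1 - (r ^ j * q ^ m) • y)) :
    qPochInf (q • y) q ^ 4 * Ring.inverse (∏ i ∈ Icc 1 4, qPochInf (r ^ i • y) q) =
      ∑ j ∈ Icc 1 4, ∑' m, ((q ^ (2 * m) * hgCoeff q r j m) * connConst q r j) •
        Ring.inverse (1 - (r ^ j * q ^ m) • y) := by
  have hq0 : q ≠ 0 := hr ▸ pow_ne_zero 5 hr0
  have hy' : ∀ j ∈ Icc 1 4, ∀ m, IsUnit (1 - q ^ m • r ^ j • y) := fun j hj m => by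
    rw [smul_smul, mul_comm]; exact hy j hj m
  have hinj : ∀ N, Set.InjOn (fun t : ℕ × ℕ => r ^ t.1 * q ^ t.2) ↑(Icc 1 4 ×ˢ range N) := by
    rintro N ⟨i, k⟩ h1 ⟨i', k'⟩ h2 h
    simp only [coe_product, Set.mem_prod, mem_coe, mem_Icc, mem_range] at h1 h2
    simp only [← hr, ← pow_mul, ← pow_add] at h
    have := not_imp_not.1 (pow_ne_pow hr0 hr1) h
    simp only [Prod.mk.injEq]
    omega
  -- the expansion of the quotient in which every infinite product is cut off after `N + 1` factors
  have hfin : ∀ N, qPoch (q • y) q (N + 1) ^ 4 *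
      Ring.inverse (∏ i ∈ Icc 1 4, qPoch (r ^ i • y) q (N + 1)) =
      algebraMap ℂ A ((q ^ 2) ^ (N + 1)) + ∑ j ∈ Icc 1 4, ∑ m ∈ range (N + 1),
        (q ^ (2 * m) * hgCoeff q r j m * connConstApprox q r j (N - m)) •
          Ring.inverse (1 - (r ^ j * q ^ m) • y) := by
    intro N
    have h := prod_one_sub_mul_inverse (s := Icc 1 4 ×ˢ range (N + 1))
      (c := fun t : ℕ × ℕ => r ^ t.1 * q ^ t.2) (fun t => q ^ (t.2 + 1))
      (fun t _ => mul_ne_zero (pow_ne_zero _ hr0) (pow_ne_zero _ hq0)) (hinj _) (y := y)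
      (fun t ht => hy t.1 (mem_product.1 ht).1 t.2)
    rw [sum_product, prod_product, prod_product, prod_product] at h
    convert h using 1
    · congr 1
      · simp only [prod_const, Nat.card_Icc, qPoch, smul_smul, pow_succ]
      · simp only [qPoch, smul_smul, mul_comm]
    · congr 1
      · congr 1
        have h1 : ∀ i k, q ^ (k + 1) / (r ^ i * q ^ k) = q / r ^ i := fun i k => by
          rw [pow_succ, mul_comm (r ^ i), mul_div_mul_left _ _ (pow_ne_zero _ hq0)]
        simp only [h1, prod_const, card_range, prod_pow]
        congr 1
        rw [prod_div_distrib, prod_pow_eq_pow_sum, eq_div_iff (pow_ne_zero _ hr0)]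
        simp only [prod_const, Nat.card_Icc]
        rw [show ∑ i ∈ Icc 1 4, i = 10 from rfl, ← hr]
        ring
      · refine sum_congr rfl fun j hj => sum_congr rfl fun m hm => ?_
        have := residue_eq hr0 hr hj m (N - m)
        rw [Nat.add_sub_cancel' (Nat.lt_succ_iff.1 (mem_range.1 hm))] at this
        rw [this]
  have hL : Tendsto (fun N => qPoch (q • y) q (N + 1) ^ 4 *
      Ring.inverse (∏ i ∈ Icc 1 4, qPoch (r ^ i • y) q (N + 1))) atTop
      (𝓝 (qPochInf (q • y) q ^ 4 * Ring.inverse (∏ i ∈ Icc 1 4, qPochInf (r ^ i • y) q))) := by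
    have h : ∀ a : A, Tendsto (fun n => qPoch a q (n + 1)) atTop (𝓝 (qPochInf a q)) := fun a =>
      (tendsto_add_atTop_iff_nat 1).2 (tendsto_qPoch hq1 a)
    exact ((h _).pow 4).mul (tendsto_ringInverse
      (IsUnit.prod_iff.2 fun i hi => isUnit_qPochInf hq1 (hy' i hi))
      (tendsto_finsetProd _ fun i _ => h _))
  have hR : ∀ j ∈ Icc 1 4, Tendsto (fun N => ∑ m ∈ range (N + 1),
        (q ^ (2 * m) * hgCoeff q r j m * connConstApprox q r j (N - m)) •
          Ring.inverse (1 - (r ^ j * q ^ m) • y)) atTop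
      (𝓝 (∑' m, ((q ^ (2 * m) * hgCoeff q r j m) * connConst q r j) •
        Ring.inverse (1 - (r ^ j * q ^ m) • y))) := by
    intro j hj
    obtain ⟨M, hM0, hM⟩ := exists_norm_le_of_tendsto (tendsto_connConstApprox hr0 hr1 hq1 hr hj)
    obtain ⟨B, hB0, hB⟩ := exists_norm_le_of_tendsto
      (tendsto_ringInverse_one_sub_pow_smul hq1 (r ^ j • y))
    have hz : ‖q ^ 2‖ < 1 := by rw [norm_pow]; exact pow_lt_one₀ (norm_nonneg _) hq1 (by norm_num)
    refine tendsto_sum_finset_of_dominated (fun m => ?_)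
      (((summable_hgCoeff_mul hr0 hr1 hq1 hr j hz).mul_right M).mul_right B) (fun m => ?_)
      fun N m _ => ?_
    · filter_upwards [eventually_ge_atTop m] with N hN
      exact mem_range.2 (Nat.lt_succ_of_le hN)
    · exact (((tendsto_connConstApprox hr0 hr1 hq1 hr hj).comp
        (tendsto_sub_atTop_nat m)).const_mul _).smul_const _
    · rw [norm_smul, norm_mul, ← pow_mul]
      have := hB m
      rw [smul_smul, mul_comm (q ^ m)] at this
      gcongr
      exact hM _
  refine tendsto_nhds_unique hL ?_
  simp_rw [hfin]
  have h0 : Tendsto (fun N => algebraMap ℂ A ((q ^ 2) ^ (N + 1))) atTop (𝓝 0) := by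
    have hz : ‖q ^ 2‖ < 1 := by rw [norm_pow]; exact pow_lt_one₀ (norm_nonneg _) hq1 (by norm_num)
    have := (continuous_algebraMap ℂ A).tendsto 0 |>.comp
      ((tendsto_add_atTop_iff_nat 1).2 (tendsto_pow_atTop_nhds_zero_of_norm_lt_one hz))
    rwa [map_zero] at this
  simpa using h0.add (tendsto_finsetSum _ hR)

end PartialFractionExpansion

/-! ### Kronecker's partial fraction expansion of a theta quotient -/

section Kronecker
variable {A : Type*} [NormedCommRing A] [NormedAlgebra ℂ A]
variable {q : ℂ}

theorem one_sub_ne_zero_of_norm_lt_one {z : ℂ} (hz : ‖z‖ < 1) : 1 - z ≠ 0 := by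
  rw [sub_ne_zero]
  rintro rfl
  simp at hz

theorem isUnit_one_sub_of_norm_lt_one (hq1 : ‖q‖ < 1) {z : ℂ} (hz : ‖z‖ < 1) (k : ℕ) :
    IsUnit (1 - q ^ k • z) := by
  refine isUnit_iff_ne_zero.2 (one_sub_ne_zero_of_norm_lt_one ?_)
  rw [norm_smul, norm_pow]
  exact (mul_le_of_le_one_left (norm_nonneg _) (pow_le_one₀ (norm_nonneg _) hq1.le)).trans_lt hz

theorem isUnit_one_sub_reflect (hq0 : q ≠ 0) {a b : A} (hab : a * b = 1)
    (ha : ∀ n : ℤ, IsUnit (1 - q ^ n • a)) (k : ℕ) : IsUnit (1 - q ^ k • q • b) := by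
  have hb : IsUnit b := IsUnit.of_mul_eq_one_right _ hab
  have h := ((IsUnit.mk0 (-q ^ (k + 1)) (neg_ne_zero.2 (pow_ne_zero _ hq0))).map
    (algebraMap ℂ A)).mul (hb.mul (ha (-(k + 1 : ℕ))))
  rw [← Algebra.smul_def, mul_sub, mul_one, mul_smul_comm, mul_comm b, hab, smul_sub, smul_smul,
    zpow_neg, zpow_natCast, neg_mul, mul_inv_cancel₀ (pow_ne_zero _ hq0), neg_smul, neg_smul,
    one_smul] at h
  rw [smul_smul, ← pow_succ]
  rwa [neg_sub_neg] at h

theorem ringInverse_reflect (hq0 : q ≠ 0) {a b : A} (hab : a * b = 1)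
    (ha : ∀ n : ℤ, IsUnit (1 - q ^ n • a)) (k : ℕ) :
    Ring.inverse (1 - q ^ (-(k + 1 : ℤ)) • a) =
      -(q ^ (k + 1) • (b * Ring.inverse (1 - q ^ k • q • b))) := by
  have hu := isUnit_one_sub_reflect hq0 hab ha k
  have hv := ha (-(k + 1 : ℤ))
  have h1 : (1 - q ^ (-(k + 1 : ℤ)) • a) * (q ^ (k + 1) • b) = -(1 - q ^ k • q • b) := by
    have h2 : q ^ (-(k + 1 : ℤ)) * q ^ (k + 1) = 1 := by
      have : (-(k + 1 : ℤ)) = -((k + 1 : ℕ) : ℤ) := by push_cast; ring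
      rw [this, zpow_neg, zpow_natCast, inv_mul_cancel₀ (pow_ne_zero _ hq0)]
    rw [sub_mul, one_mul, smul_mul_smul_comm, hab, h2, one_smul, smul_smul, ← pow_succ]
    ring
  rw [← hv.mul_right_inj, Ring.mul_inverse_cancel _ hv, ← smul_mul_assoc, mul_neg, ← mul_assoc, h1,
    neg_mul, neg_neg, Ring.mul_inverse_cancel _ hu]

/-- The coefficient `(q/Q; q)_m (Q; q)_{n+1} / ((q; q)_m (q; q)_n)` of the partial fraction
expansion of a finite theta quotient, up to a power of `Q`. -/
def thetaResidue (q Q : ℂ) (m n : ℕ) : ℂ :=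
  qPoch (q / Q) q m * qPoch Q q (n + 1) / (qPoch q q m * qPoch q q n)

/-- The partial fraction expansion of the finite theta quotient
`∏_{-N ≤ k < N} (1 - Q q^k a) / (1 - q^k a)`, divided by `Q^N`; here `b = a⁻¹`. -/
theorem finite_kronecker (hq0 : q ≠ 0) (hq1 : ‖q‖ < 1) {a b : A} (hab : a * b = 1)
    (ha : ∀ n : ℤ, IsUnit (1 - q ^ n • a)) {Q : ℂ} (hQ : Q ≠ 0) (N : ℕ) :
    (qPoch (Q • a) q N * qPoch ((q / Q) • b) q N) *
        Ring.inverse (qPoch a q N * qPoch (q • b) q N) =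
      algebraMap ℂ A (Q ^ N) + ∑ n ∈ Ico (-N : ℤ) N,
        (Q ^ n * thetaResidue q Q (N + n).toNat (N - 1 - n).toNat) •
          Ring.inverse (1 - q ^ n • a) := by
  have hq : ∀ (k : ℕ), q ^ k • (q ^ N)⁻¹ • a = q ^ (k - N : ℤ) • a := fun k => by
    rw [smul_smul, zpow_sub₀ hq0, zpow_natCast, zpow_natCast, div_eq_mul_inv]
  have hinj : Set.InjOn (fun k => q ^ k) (range (N + N) : Set ℕ) := fun i _ j _ h =>
    not_imp_not.1 (pow_ne_pow hq0 hq1) h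
  have h := prod_one_sub_mul_inverse (s := range (N + N)) (c := fun k => q ^ k) (fun k => Q * q ^ k)
    (fun _ _ => pow_ne_zero _ hq0) hinj (y := (q ^ N)⁻¹ • a) (fun k _ => by rw [hq]; exact ha _)
  have hnum : ∏ k ∈ range (N + N), (1 - (Q * q ^ k) • (q ^ N)⁻¹ • a) =
      (reflectFactor q N • a ^ N) * (Q ^ N • (qPoch (Q • a) q N * qPoch ((q / Q) • b) q N)) := by
    have h3 := qPoch_inv_pow_smul_add hq0 (u := Q • a) (v := Q⁻¹ • b)
      (by rw [smul_mul_smul_comm, hab, mul_inv_cancel₀ hQ, one_smul]) N N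
    rw [smul_smul q, ← div_eq_mul_inv, _root_.smul_pow] at h3
    have h4 : qPoch ((q ^ N)⁻¹ • Q • a) q (N + N) =
        ∏ k ∈ range (N + N), (1 - (Q * q ^ k) • (q ^ N)⁻¹ • a) :=
      prod_congr rfl fun k _ => by simp only [smul_smul]; congr 2; ring
    rw [← h4, h3]
    simp only [smul_mul_assoc, mul_smul_comm]
    rw [smul_comm (Q ^ N)]
    congr 2
    ring
  have hden : ∏ k ∈ range (N + N), (1 - q ^ k • (q ^ N)⁻¹ • a) =
      (reflectFactor q N • a ^ N) * (qPoch a q N * qPoch (q • b) q N) := by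
    have h3 := qPoch_inv_pow_smul_add hq0 hab N N
    rw [qPoch] at h3
    rw [h3]
    simp only [smul_mul_assoc]
    congr 1
    ring
  have hunit : IsUnit (reflectFactor q N • a ^ N) := by
    rw [Algebra.smul_def]
    exact ((IsUnit.mk0 _ (reflectFactor_ne_zero hq0 N)).map _).mul
      ((IsUnit.of_mul_eq_one _ hab).pow _)
  have hQN := pow_ne_zero N hQ
  have hlhs : (∏ k ∈ range (N + N), (1 - (Q * q ^ k) • (q ^ N)⁻¹ • a)) *
      Ring.inverse (∏ k ∈ range (N + N), (1 - q ^ k • (q ^ N)⁻¹ • a)) =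
      Q ^ N • ((qPoch (Q • a) q N * qPoch ((q / Q) • b) q N) *
        Ring.inverse (qPoch a q N * qPoch (q • b) q N)) := by
    rw [hnum, hden, Ring.mul_inverse_rev (reflectFactor q N • a ^ N),
      ← smul_mul_assoc (Q ^ N) (qPoch (Q • a) q N * qPoch ((q / Q) • b) q N)]
    linear_combination (Q ^ N • (qPoch (Q • a) q N * qPoch ((q / Q) • b) q N) *
      Ring.inverse (qPoch a q N * qPoch (q • b) q N)) * Ring.mul_inverse_cancel _ hunit
  have hres : ∀ k ∈ range (N + N), (∏ t ∈ range (N + N), (1 - Q * q ^ t / q ^ k)) /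
      ∏ t ∈ (range (N + N)).erase k, (1 - q ^ t / q ^ k) =
      Q ^ k * thetaResidue q Q k (N + N - 1 - k) := by
    intro k hk
    obtain ⟨n, hn⟩ : ∃ n, N + N = k + (n + 1) := ⟨N + N - 1 - k, by rw [mem_range] at hk; omega⟩
    have h3 := qPoch_inv_pow_smul_add hq0 (mul_inv_cancel₀ hQ) k (n + 1)
    have h4 : qPoch ((q ^ k)⁻¹ • Q) q (k + (n + 1)) =
        ∏ t ∈ range (k + (n + 1)), (1 - Q * q ^ t / q ^ k) :=
      prod_congr rfl fun t _ => by simp only [smul_eq_mul]; congr 1; field_simp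
    rw [hn, prod_erase_one_sub_div hq0, ← h4, h3, show k + (n + 1) - 1 - k = n by omega,
      thetaResidue, smul_eq_mul, smul_eq_mul, mul_assoc, mul_assoc (reflectFactor q k),
      mul_div_mul_left _ _ (reflectFactor_ne_zero hq0 k), ← div_eq_mul_inv, mul_assoc,
      mul_div_assoc]
  have hconst : ∏ k ∈ range (N + N), Q * q ^ k / q ^ k = Q ^ N * Q ^ N := by
    rw [prod_congr rfl fun k _ => mul_div_cancel_right₀ Q (pow_ne_zero k hq0), prod_const,
      card_range, pow_add]
  have hsum : ∑ n ∈ Ico (-N : ℤ) N, (Q ^ n * thetaResidue q Q (N + n).toNat (N - 1 - n).toNat) •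
      Ring.inverse (1 - q ^ n • a) = (Q ^ N)⁻¹ • ∑ k ∈ range (N + N),
        (Q ^ k * thetaResidue q Q k (N + N - 1 - k)) • Ring.inverse (1 - q ^ (k - N : ℤ) • a) := by
    rw [smul_sum]
    refine sum_nbij' (fun n => (N + n).toNat) (fun k => (k - N : ℤ)) ?_ ?_ ?_ ?_ ?_
    · intro n hn; rw [mem_Ico] at hn; rw [mem_range]; omega
    · intro k hk; rw [mem_range] at hk; rw [mem_Ico]; omega
    · intro n hn; rw [mem_Ico] at hn; omega
    · intro k hk; omega
    · intro n hn
      rw [mem_Ico] at hn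
      have e1 : (((N + n).toNat : ℕ) - N : ℤ) = n := by omega
      have e2 : N + N - 1 - (N + n).toNat = (N - 1 - n).toNat := by omega
      have e3 : (Q ^ N)⁻¹ * Q ^ (N + n).toNat = Q ^ n := by
        rw [← zpow_natCast Q (N + n).toNat, Int.toNat_of_nonneg (by omega), zpow_add₀ hQ,
          zpow_natCast, inv_mul_cancel_left₀ hQN]
      rw [e1, e2, smul_smul, ← mul_assoc, e3]
  rw [hlhs, hconst, sum_congr rfl fun k hk => by rw [hres k hk, hq k]] at h
  rw [hsum, ← inv_smul_smul₀ hQN (_ * Ring.inverse _), h, smul_add,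
    Algebra.smul_def _ (algebraMap ℂ A _), ← map_mul, inv_mul_cancel_left₀ hQN]

variable [CompleteSpace A]

theorem summable_kronecker (hq0 : q ≠ 0) (hq1 : ‖q‖ < 1) {a b : A} (hab : a * b = 1)
    (ha : ∀ n : ℤ, IsUnit (1 - q ^ n • a)) {Q : ℂ} (h1 : ‖q‖ < ‖Q‖) (h2 : ‖Q‖ < 1) :
    Summable fun n : ℤ => ‖Q ^ n • Ring.inverse (1 - q ^ n • a)‖ := by
  have hQ : 0 < ‖Q‖ := (norm_nonneg q).trans_lt h1
  obtain ⟨M, hM0, hM⟩ := exists_norm_le_of_tendsto (tendsto_ringInverse_one_sub_pow_smul hq1 a)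
  obtain ⟨B, hB0, hB⟩ := exists_norm_le_of_tendsto
    (tendsto_ringInverse_one_sub_pow_smul hq1 (q • b))
  refine Summable.of_nat_of_neg_add_one ?_ ?_
  · refine ((summable_geometric_of_lt_one (norm_nonneg _) h2).mul_right M).of_nonneg_of_le
      (fun _ => norm_nonneg _) fun n => ?_
    rw [norm_smul, zpow_natCast, zpow_natCast, norm_pow]
    gcongr
    exact hM n
  · have h3 : ‖q‖ / ‖Q‖ < 1 := (div_lt_one hQ).2 h1
    refine ((summable_geometric_of_lt_one (by positivity) h3).mul_right
      (‖q‖ / ‖Q‖ * (‖b‖ * B))).of_nonneg_of_le (fun _ => norm_nonneg _) fun n => ?_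
    rw [ringInverse_reflect hq0 hab ha, smul_neg, norm_neg, smul_smul, norm_smul, norm_mul,
      norm_zpow, norm_pow, ← mul_assoc, ← pow_succ]
    have h4 : ‖Q‖ ^ (-(n + 1 : ℤ)) * ‖q‖ ^ (n + 1) = (‖q‖ / ‖Q‖) ^ (n + 1) := by
      have : (-(n + 1 : ℤ)) = -((n + 1 : ℕ) : ℤ) := by push_cast; ring
      rw [this, zpow_neg, zpow_natCast, div_pow, div_eq_inv_mul]
    rw [h4]
    gcongr
    exact (norm_mul_le _ _).trans (by gcongr; exact hB n)

variable [NormOneClass A]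

/-- Kronecker's expansion `∑_{n ∈ ℤ} Q^n / (1 - q^n a)` of a theta quotient, for `a` in a Banach
algebra with inverse `b`. -/
theorem hasSum_kronecker (hq0 : q ≠ 0) (hq1 : ‖q‖ < 1) {a b : A} (hab : a * b = 1)
    (ha : ∀ n : ℤ, IsUnit (1 - q ^ n • a)) {Q : ℂ} (h1 : ‖q‖ < ‖Q‖) (h2 : ‖Q‖ < 1) :
    HasSum (fun n : ℤ => Q ^ n • Ring.inverse (1 - q ^ n • a))
      ((qPochInf q q ^ 2 / (qPochInf Q q * qPochInf (q / Q) q)) •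
        ((qPochInf (Q • a) q * qPochInf ((q / Q) • b) q) *
          Ring.inverse (qPochInf a q * qPochInf (q • b) q))) := by
  have hQ0 : 0 < ‖Q‖ := (norm_nonneg q).trans_lt h1
  have hQ : Q ≠ 0 := norm_pos_iff.1 hQ0
  have hqQ : ‖q / Q‖ < 1 := by rw [norm_div]; exact (div_lt_one hQ0).2 h1
  have hs := summable_kronecker hq0 hq1 hab ha h1 h2
  have hne : ∀ z : ℂ, ‖z‖ < 1 → qPochInf z q ≠ 0 := fun z hz =>
    (isUnit_qPochInf hq1 (isUnit_one_sub_of_norm_lt_one hq1 hz)).ne_zero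
  have ha' : ∀ k : ℕ, IsUnit (1 - q ^ k • a) := fun k => by simpa using ha k
  have hL : Tendsto (fun N => (qPoch (Q • a) q N * qPoch ((q / Q) • b) q N) *
        Ring.inverse (qPoch a q N * qPoch (q • b) q N)) atTop
      (𝓝 ((qPochInf (Q • a) q * qPochInf ((q / Q) • b) q) *
        Ring.inverse (qPochInf a q * qPochInf (q • b) q))) :=
    ((tendsto_qPoch hq1 _).mul (tendsto_qPoch hq1 _)).mul (tendsto_ringInverse
      ((isUnit_qPochInf hq1 ha').mul (isUnit_qPochInf hq1 (isUnit_one_sub_reflect hq0 hab ha)))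
      ((tendsto_qPoch hq1 _).mul (tendsto_qPoch hq1 _)))
  set E : ℂ := qPochInf (q / Q) q * qPochInf Q q / (qPochInf q q * qPochInf q q) with hE
  have hu : Tendsto (fun m => qPoch (q / Q) q m / qPoch q q m) atTop
      (𝓝 (qPochInf (q / Q) q / qPochInf q q)) :=
    (tendsto_qPoch hq1 _).div (tendsto_qPoch hq1 _) (hne _ hq1)
  have hv : Tendsto (fun n => qPoch Q q (n + 1) / qPoch q q n) atTop
      (𝓝 (qPochInf Q q / qPochInf q q)) :=
    ((tendsto_add_atTop_iff_nat 1).2 (tendsto_qPoch hq1 _)).div (tendsto_qPoch hq1 _) (hne _ hq1)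
  obtain ⟨M, hM0, hM⟩ := exists_norm_le_of_tendsto hu
  obtain ⟨B, hB0, hB⟩ := exists_norm_le_of_tendsto hv
  have hR : Tendsto (fun N : ℕ => ∑ n ∈ Ico (-N : ℤ) N,
        (Q ^ n * thetaResidue q Q (N + n).toNat (N - 1 - n).toNat) •
          Ring.inverse (1 - q ^ n • a)) atTop
      (𝓝 (∑' n : ℤ, (Q ^ n * E) • Ring.inverse (1 - q ^ n • a))) := by
    refine tendsto_sum_finset_of_dominated (fun n => ?_) (hs.mul_left (M * B)) (fun n => ?_)
      fun N n _ => ?_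
    · filter_upwards [eventually_ge_atTop (n.natAbs + 1)] with N hN
      rw [mem_Ico]
      omega
    · refine Tendsto.smul_const (Tendsto.const_mul _ ?_) _
      have t1 : Tendsto (fun N : ℕ => (N + n).toNat) atTop atTop :=
        tendsto_atTop_atTop.2 fun c => ⟨c + n.natAbs, fun N hN => by omega⟩
      have t2 : Tendsto (fun N : ℕ => (N - 1 - n).toNat) atTop atTop :=
        tendsto_atTop_atTop.2 fun c => ⟨c + n.natAbs + 1, fun N hN => by omega⟩
      have := (hu.comp t1).mul (hv.comp t2)
      rw [div_mul_div_comm, ← hE] at this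
      exact this.congr fun N => div_mul_div_comm _ _ _ _
    · rw [mul_comm (Q ^ n), mul_smul, norm_smul, thetaResidue, ← div_mul_div_comm, norm_mul]
      gcongr
      · exact hM _
      · exact hB _
  have h0 : Tendsto (fun N => algebraMap ℂ A (Q ^ N)) atTop (𝓝 0) := by
    have := (continuous_algebraMap ℂ A).tendsto 0 |>.comp
      (tendsto_pow_atTop_nhds_zero_of_norm_lt_one h2)
    rwa [map_zero] at this
  have key := tendsto_nhds_unique hL
    ((h0.add hR).congr fun N => (finite_kronecker hq0 hq1 hab ha hQ N).symm)
  have hE0 : E ≠ 0 :=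
    div_ne_zero (mul_ne_zero (hne _ hqQ) (hne _ h2)) (mul_ne_zero (hne _ hq1) (hne _ hq1))
  have hE1 : qPochInf q q ^ 2 / (qPochInf Q q * qPochInf (q / Q) q) = E⁻¹ := by
    rw [hE, inv_div, sq, mul_comm (qPochInf Q q)]
  have h5 : ∀ n : ℤ, (Q ^ n * E) • Ring.inverse (1 - q ^ n • a) =
      E • (Q ^ n • Ring.inverse (1 - q ^ n • a)) := fun n => by rw [mul_comm, mul_smul]
  rw [key, hE1, zero_add]
  simp_rw [h5]
  rw [tsum_const_smul'' E, smul_smul, inv_mul_cancel₀ hE0, one_smul]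
  exact hs.of_norm.hasSum

end Kronecker

/-! ### Jacobi's triple product identity -/

section JacobiTripleProduct
variable {q : ℂ}

theorem qPoch_ne_zero_of_norm_lt_one (hq1 : ‖q‖ < 1) {z : ℂ} (hz : ‖z‖ < 1) (n : ℕ) :
    qPoch z q n ≠ 0 :=
  (isUnit_qPoch (isUnit_one_sub_of_norm_lt_one hq1 hz) n).ne_zero

theorem qPochInf_ne_zero_of_norm_lt_one (hq1 : ‖q‖ < 1) {z : ℂ} (hz : ‖z‖ < 1) :
    qPochInf z q ≠ 0 :=
  (isUnit_qPochInf hq1 (isUnit_one_sub_of_norm_lt_one hq1 hz)).ne_zero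

/-- The Gaussian binomial coefficient, as a quotient of `q`-Pochhammer symbols. -/
def qBinom (q : ℂ) (n k : ℕ) : ℂ :=
  if k ≤ n then qPoch q q n / (qPoch q q k * qPoch q q (n - k)) else 0

theorem qBinom_zero_right (hq1 : ‖q‖ < 1) (n : ℕ) : qBinom q n 0 = 1 := by
  simp [qBinom, div_self (qPoch_ne_zero_of_norm_lt_one hq1 hq1 n)]

theorem qBinom_self (hq1 : ‖q‖ < 1) (n : ℕ) : qBinom q n n = 1 := by
  simp [qBinom, div_self (qPoch_ne_zero_of_norm_lt_one hq1 hq1 n)]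

/-- The `q`-analogue of Pascal's rule. -/
theorem qBinom_succ_succ (hq1 : ‖q‖ < 1) (n k : ℕ) (hk : k ≤ n) :
    qBinom q (n + 1) (k + 1) = qBinom q n (k + 1) + q ^ (n - k) * qBinom q n k := by
  have h := qPoch_ne_zero_of_norm_lt_one hq1 hq1
  rcases hk.eq_or_lt with rfl | hk
  · rw [qBinom_self hq1, qBinom_self hq1, qBinom, if_neg (by omega)]
    simp
  · obtain ⟨m, rfl⟩ := Nat.exists_eq_add_of_lt hk
    rw [qBinom, qBinom, qBinom, if_pos (by omega), if_pos (by omega), if_pos (by omega),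
      show k + m + 1 + 1 - (k + 1) = m + 1 by omega, show k + m + 1 - (k + 1) = m by omega,
      show k + m + 1 - k = m + 1 by omega]
    have h1 := h (k + 1)
    have h2 := h (m + 1)
    have h3 := h k
    have h4 := h m
    rw [qPoch_succ] at h1 h2
    have h5 := right_ne_zero_of_mul h1
    have h6 := right_ne_zero_of_mul h2
    rw [qPoch_succ q (k + m + 1), qPoch_succ q k, qPoch_succ q m]
    simp only [smul_eq_mul] at *
    obtain ⟨X, hX⟩ : ∃ X, X = 1 - q ^ k * q := ⟨_, rfl⟩
    obtain ⟨Y, hY⟩ : ∃ Y, Y = 1 - q ^ m * q := ⟨_, rfl⟩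
    rw [← hX] at h5 ⊢
    rw [← hY] at h6 ⊢
    field_simp
    linear_combination qPoch q q (k + m + 1) * (-hY - q ^ (m + 1) * hX)

theorem succ_choose_two (n : ℕ) : (n + 1).choose 2 = n + n.choose 2 := by
  rw [Nat.choose_succ_succ' n 1, Nat.choose_one_right]

/-- The `q`-binomial theorem. -/
theorem qPoch_neg_eq_sum (hq1 : ‖q‖ < 1) (x : ℂ) (n : ℕ) :
    qPoch (-x) q n = ∑ k ∈ range (n + 1), q ^ (k.choose 2) * qBinom q n k * x ^ k := by
  induction n with
  | zero => simp [qBinom_zero_right hq1]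
  | succ n ih =>
    have h1 : ∀ k ∈ range (n + 1), q ^ ((k + 1).choose 2) * qBinom q (n + 1) (k + 1) * x ^ (k + 1) =
        q ^ ((k + 1).choose 2) * qBinom q n (k + 1) * x ^ (k + 1) +
          q ^ n * x * (q ^ (k.choose 2) * qBinom q n k * x ^ k) := by
      intro k hk
      have hk := Nat.lt_succ_iff.1 (mem_range.1 hk)
      have h2 : q ^ ((k + 1).choose 2) * q ^ (n - k) = q ^ n * q ^ (k.choose 2) := by
        rw [succ_choose_two, ← pow_add, ← pow_add]
        congr 1; omega
      rw [qBinom_succ_succ hq1 n k hk]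
      linear_combination (qBinom q n k * x ^ (k + 1)) * h2
    have h3 : qBinom q n (n + 1) = 0 := if_neg (by omega)
    rw [sum_range_succ', sum_congr rfl h1, sum_add_distrib, ← mul_sum, ← ih, qPoch_succ,
      add_right_comm, qBinom_zero_right hq1, ← qBinom_zero_right hq1 n,
      ← sum_range_succ' (fun k => q ^ (k.choose 2) * qBinom q n k * x ^ k), sum_range_succ, h3,
      ← ih, smul_eq_mul, qBinom_zero_right hq1]
    ring

theorem summable_pow_choose_two_mul_pow {t s : ℝ} (ht0 : 0 < t) (ht1 : t < 1) (hs : 0 < s) :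
    Summable fun n : ℕ => t ^ (n.choose 2) * s ^ n := by
  refine summable_of_ratio_test_tendsto_lt_one (l := 0) zero_lt_one
    (Eventually.of_forall fun n => by positivity) ?_
  have h : Tendsto (fun n : ℕ => t ^ n * s) atTop (𝓝 0) := by
    simpa using (tendsto_pow_atTop_nhds_zero_of_lt_one ht0.le ht1).mul_const s
  refine h.congr fun n => ?_
  rw [Real.norm_of_nonneg (by positivity), Real.norm_of_nonneg (by positivity),
    eq_div_iff (by positivity), Nat.choose_succ_succ' n 1, Nat.choose_one_right]
  ring

theorem two_mul_choose_two (n : ℕ) : (2 * (n.choose 2 : ℕ) : ℤ) = n * (n - 1) := by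
  induction n with
  | zero => simp
  | succ n ih => rw [succ_choose_two]; push_cast; linarith

theorem summable_theta (hq0 : q ≠ 0) (hq1 : ‖q‖ < 1) {Q : ℂ} (hQ : Q ≠ 0) :
    Summable fun d : ℤ => ‖q ^ (d * (d - 1) / 2) * Q ^ d‖ := by
  have hq := norm_pos_iff.2 hq0
  have hQ' := norm_pos_iff.2 hQ
  refine Summable.of_nat_of_neg_add_one ?_ ?_
  · refine (summable_pow_choose_two_mul_pow hq hq1 hQ').congr fun n => ?_
    rw [← two_mul_choose_two, Int.mul_ediv_cancel_left _ two_ne_zero, norm_mul, norm_zpow,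
      norm_zpow, zpow_natCast, zpow_natCast]
  · refine (((summable_nat_add_iff 2).2
      (summable_pow_choose_two_mul_pow hq hq1 (inv_pos.2 hQ'))).mul_right ‖Q‖).congr fun n => ?_
    have h : (-(n + 1 : ℤ)) * (-(n + 1 : ℤ) - 1) = 2 * ((n + 2).choose 2 : ℕ) := by
      rw [two_mul_choose_two]; push_cast; ring
    have h2 : (-(n + 1 : ℤ)) = -((n + 1 : ℕ) : ℤ) := by push_cast; ring
    rw [h, Int.mul_ediv_cancel_left _ two_ne_zero, norm_mul, norm_zpow, norm_zpow, h2, zpow_neg,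
      zpow_natCast, zpow_natCast, inv_pow]
    field_simp
    ring

/-- The `q`-binomial theorem for `2N` factors, centred at the middle term. -/
theorem finite_jacobi (hq0 : q ≠ 0) (hq1 : ‖q‖ < 1) {Q : ℂ} (hQ : Q ≠ 0) (N : ℕ) :
    qPoch (-Q) q N * qPoch (-(q / Q)) q N = ∑ d ∈ Icc (-N : ℤ) N,
      q ^ (d * (d - 1) / 2) * Q ^ d * qBinom q (N + N) (N + d).toNat := by
  have h1 := qPoch_inv_pow_smul_add hq0 (u := -Q) (v := -Q⁻¹) (by field_simp) N N
  have h2 := qPoch_neg_eq_sum hq1 ((q ^ N)⁻¹ * Q) (N + N)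
  have h3 : reflectFactor q N * (-Q) ^ N = (q ^ ((N + 1).choose 2))⁻¹ * Q ^ N := by
    have : reflectFactor q N = (-1) ^ N * (q ^ ((N + 1).choose 2))⁻¹ := by
      clear h1 h2
      induction N with
      | zero => simp [reflectFactor]
      | succ n ih =>
        rw [reflectFactor, prod_range_succ, ← reflectFactor, ih, succ_choose_two (n + 1), pow_add]
        field_simp
        ring
    rw [this, neg_pow Q]
    have h5 : (-1 : ℂ) ^ N * (-1) ^ N = 1 := by rw [← mul_pow]; simp
    linear_combination (q ^ ((N + 1).choose 2))⁻¹ * Q ^ N * h5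
  simp only [smul_eq_mul] at h1
  rw [mul_neg, h2, mul_neg, ← div_eq_mul_inv, ← mul_assoc (reflectFactor q N), h3] at h1
  have hA := pow_ne_zero ((N + 1).choose 2) hq0
  have hB := pow_ne_zero N hQ
  have h4 : qPoch (-Q) q N * qPoch (-(q / Q)) q N = q ^ ((N + 1).choose 2) * (Q ^ N)⁻¹ *
      ∑ k ∈ range (N + N + 1), q ^ (k.choose 2) * qBinom q (N + N) k * ((q ^ N)⁻¹ * Q) ^ k := by
    rw [h1]; field_simp
  rw [h4, mul_sum]
  refine (sum_nbij' (fun n : ℤ => (N + n).toNat) (fun k : ℕ => (k - N : ℤ)) ?_ ?_ ?_ ?_ ?_).symm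
  · intro n hn; rw [mem_Icc] at hn; rw [mem_range]; omega
  · intro k hk; rw [mem_range] at hk; rw [mem_Icc]; omega
  · intro n hn; rw [mem_Icc] at hn; omega
  · intro k hk; omega
  · intro d hd
    rw [mem_Icc] at hd
    obtain ⟨k, hk⟩ : ∃ k : ℕ, N + d = k := ⟨(N + d).toNat, by omega⟩
    have hd' : d = k - N := by omega
    have e1 : d * (d - 1) = 2 * (((N + 1).choose 2 : ℕ) + (k.choose 2 : ℕ) - N * k) := by
      have a1 := two_mul_choose_two (N + 1)
      have a2 := two_mul_choose_two k
      push_cast at a1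
      rw [hd']
      linear_combination -a1 - a2
    rw [hk, Int.toNat_natCast, e1, Int.mul_ediv_cancel_left _ two_ne_zero, zpow_sub₀ hq0,
      zpow_add₀ hq0, hd', zpow_sub₀ hQ]
    simp only [zpow_natCast, mul_pow, inv_pow, ← pow_mul]
    rw [show ((N : ℤ) * k) = ((N * k : ℕ) : ℤ) by push_cast; ring, zpow_natCast]
    field_simp

/-- Jacobi's triple product identity, as the limit of the `q`-binomial theorem. -/
theorem theta_eq_mul (hq0 : q ≠ 0) (hq1 : ‖q‖ < 1) {Q : ℂ} (hQ : Q ≠ 0) :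
    theta q Q = qPochInf q q * (qPochInf (-Q) q * qPochInf (-(q / Q)) q) := by
  have hne := qPochInf_ne_zero_of_norm_lt_one hq1 hq1
  obtain ⟨M, hM0, hM⟩ := exists_norm_le_of_tendsto (tendsto_qPoch hq1 q)
  obtain ⟨B, hB0, hB⟩ := exists_norm_le_of_tendsto ((tendsto_qPoch hq1 q).inv₀ hne)
  have hR : Tendsto (fun N : ℕ => ∑ d ∈ Icc (-N : ℤ) N,
      q ^ (d * (d - 1) / 2) * Q ^ d * qBinom q (N + N) (N + d).toNat) atTop
      (𝓝 (∑' d : ℤ, q ^ (d * (d - 1) / 2) * Q ^ d * (qPochInf q q)⁻¹)) := by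
    refine tendsto_sum_finset_of_dominated (fun n => ?_)
      ((summable_theta hq0 hq1 hQ).mul_right (M * (B * B))) (fun d => ?_) fun N d hd => ?_
    · filter_upwards [eventually_ge_atTop n.natAbs] with N hN
      rw [mem_Icc]
      omega
    · refine Tendsto.const_mul _ ?_
      have t0 : Tendsto (fun N : ℕ => N + N) atTop atTop :=
        tendsto_atTop_atTop.2 fun c => ⟨c, fun N hN => by omega⟩
      have t1 : Tendsto (fun N : ℕ => (N + d).toNat) atTop atTop :=
        tendsto_atTop_atTop.2 fun c => ⟨c + d.natAbs, fun N hN => by omega⟩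
      have t2 : Tendsto (fun N : ℕ => N + N - (N + d).toNat) atTop atTop :=
        tendsto_atTop_atTop.2 fun c => ⟨c + d.natAbs, fun N hN => by omega⟩
      have t := tendsto_qPoch hq1 q
      have := (t.comp t0).div ((t.comp t1).mul (t.comp t2)) (mul_ne_zero hne hne)
      rw [div_mul_cancel_left₀ hne] at this
      refine this.congr' ?_
      filter_upwards [eventually_ge_atTop d.natAbs] with N hN
      rw [qBinom, if_pos (by omega)]
      rfl
    · rw [norm_mul]
      gcongr
      rw [mem_Icc] at hd
      rw [qBinom, if_pos (by omega), div_eq_mul_inv, mul_inv, norm_mul, norm_mul]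
      gcongr
      exacts [hM _, hB _, hB _]
  have key := tendsto_nhds_unique ((tendsto_qPoch hq1 (-Q)).mul (tendsto_qPoch hq1 (-(q / Q))))
    (hR.congr fun N => (finite_jacobi hq0 hq1 hQ N).symm)
  rw [key, tsum_mul_right, mul_comm (tsum _), mul_inv_cancel_left₀ hne, theta]

theorem isUnit_one_sub_of_mem_offSpiral {Q : ℂ} (hQ : Q ∈ offSpiral q 1) (k : ℕ) :
    IsUnit (1 - q ^ k • Q) := by
  refine isUnit_iff_ne_zero.2 fun h => hQ.2 (-k) ?_
  rw [sub_eq_zero, smul_eq_mul] at h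
  rw [one_mul, zpow_neg, zpow_natCast]
  exact eq_inv_of_mul_eq_one_right h.symm

theorem isUnit_one_sub_div_of_mem_offSpiral {Q : ℂ} (hQ : Q ∈ offSpiral q 1) (a k : ℕ) :
    IsUnit (1 - q ^ k • (q ^ a / Q)) := by
  refine isUnit_iff_ne_zero.2 fun h => hQ.2 (k + a : ℕ) ?_
  rw [sub_eq_zero, smul_eq_mul, ← mul_div_assoc, eq_div_iff hQ.1, one_mul, ← pow_add] at h
  rw [one_mul, zpow_natCast, h]

/-- By the triple product, `θ_q` vanishes only on the spiral `-q^ℤ`. -/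
theorem theta_ne_zero (hq0 : q ≠ 0) (hq1 : ‖q‖ < 1) {z : ℂ} (hz : z ∈ offSpiral q (-1)) :
    theta q z ≠ 0 := by
  have hz' : -z ∈ offSpiral q 1 :=
    ⟨neg_ne_zero.2 hz.1, fun k h => hz.2 k (by rw [neg_eq_iff_eq_neg.1 h]; ring)⟩
  have h1 := (isUnit_qPochInf hq1 (isUnit_one_sub_of_mem_offSpiral hz')).ne_zero
  have h2 := (isUnit_qPochInf hq1 (isUnit_one_sub_div_of_mem_offSpiral hz' 1)).ne_zero
  rw [pow_one, div_neg] at h2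
  rw [theta_eq_mul hq0 hq1 hz.1]
  exact mul_ne_zero (qPochInf_ne_zero_of_norm_lt_one hq1 hq1) (mul_ne_zero h1 h2)

theorem analyticAt_theta (hq0 : q ≠ 0) (hq1 : ‖q‖ < 1) {z : ℂ} (hz : z ≠ 0) :
    AnalyticAt ℂ (theta q) z := by
  have hd : ∀ a : ℂ, Differentiable ℂ fun x : ℂ => qPochInf (x * a) q := fun a =>
    differentiable_qPochInf_smul hq1 a
  have h1 : AnalyticAt ℂ (fun x => qPochInf (x * (-1)) q) z := (hd _).analyticAt z
  have h2 : AnalyticAt ℂ (fun x => qPochInf (x⁻¹ * (-q)) q) z :=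
    ((hd (-q)).analyticAt z⁻¹).comp (f := fun x : ℂ => x⁻¹) (analyticAt_inv hz)
  refine ((analyticAt_const (v := qPochInf q q)).mul (h1.mul h2)).congr ?_
  filter_upwards [isOpen_ne.mem_nhds hz] with x hx
  rw [theta_eq_mul hq0 hq1 hx]
  simp [div_eq_inv_mul]

end JacobiTripleProduct

/-! ### Continuation of power series whose coefficients interpolate a holomorphic function -/

section Continuation
variable {E : Type*} [NormedAddCommGroup E] [NormedSpace ℂ E] [CompleteSpace E] {q : ℂ}

theorem norm_qPochInf_le (hq1 : ‖q‖ < 1) (z : ℂ) :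
    ‖qPochInf z q‖ ≤ Real.exp (‖z‖ / (1 - ‖q‖)) :=
  le_of_tendsto (tendsto_qPoch hq1 z).norm (Eventually.of_forall (norm_qPoch_le hq1 z))

/-- If `g` is holomorphic on a disc of radius greater than one, with Taylor coefficients `δ n`, then
`∑ d, g (q ^ d) Q ^ d = ∑ n, δ n / (1 - q ^ n Q)`, and the right-hand side is meromorphic, with
poles in `q ^ (-n)` only. The zeros of `(Q; q)_∞` are these points. -/
theorem exists_analytic_continuation (hq1 : ‖q‖ < 1) {R : ℝ} (hR : 1 < R) {g : ℂ → E}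
    (hg : DifferentiableOn ℂ g (Metric.ball 0 R)) :
    ∃ G : ℂ → E, (∀ Q, ‖Q‖ < 1 → HasSum (fun d : ℕ => Q ^ d • g (q ^ d)) (G Q)) ∧
      ∀ Q, qPochInf Q q ≠ 0 → AnalyticAt ℂ G Q := by
  -- Taylor coefficients of `g`, which are summable since the radius exceeds `1`
  obtain ⟨δ, hδs, hδ⟩ : ∃ δ : ℕ → E, Summable (fun n => ‖δ n‖) ∧
      ∀ x : ℂ, ‖x‖ ≤ 1 → HasSum (fun n => x ^ n • δ n) (g x) := by
    obtain ⟨R', hR1, hR2⟩ := exists_between hR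
    lift R' to NNReal using by linarith
    have hps := (hg.mono (Metric.closedBall_subset_ball hR2)).hasFPowerSeriesOnBall
      (lt_of_le_of_lt zero_le_one hR1)
    refine ⟨fun n => (cauchyPowerSeries g 0 R').coeff n, ?_, fun x hx => ?_⟩
    · have := (cauchyPowerSeries g 0 R').summable_norm_mul_pow (r := 1)
        (lt_of_lt_of_le (by exact_mod_cast hR1) hps.r_le)
      refine this.congr fun n => ?_
      rw [NNReal.coe_one, one_pow, mul_one, FormalMultilinearSeries.norm_apply_eq_norm_coef]
    · have := hps.hasSum (y := x) (by
        rw [Metric.eball_coe, mem_ball_zero_iff]; exact hx.trans_lt hR1)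
      simpa using this
  -- `t Q n` is `δ n / (1 - q ^ n Q)` times `(Q; q)_∞`, which clears all the denominators at once
  set t : ℂ → ℕ → E := fun Q n => (qPoch Q q n * qPochInf (q ^ (n + 1) • Q) q) • δ n with ht
  set H : ℂ → E := fun Q => ∑' n, t Q n with hH
  have hfac : ∀ (Q : ℂ) (n : ℕ), qPochInf Q q =
      (1 - q ^ n • Q) * (qPoch Q q n * qPochInf (q ^ (n + 1) • Q) q) := fun Q n => by
    rw [qPochInf_eq_qPoch_mul hq1 Q (n + 1), qPoch_succ]; ring
  have hb : ∀ (Q : ℂ) (n : ℕ), ‖t Q n‖ ≤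
      Real.exp (‖Q‖ / (1 - ‖q‖)) * Real.exp (‖Q‖ / (1 - ‖q‖)) * ‖δ n‖ := by
    intro Q n
    rw [ht, norm_smul, norm_mul]
    have h1 : 0 < 1 - ‖q‖ := by linarith
    have h2 : ‖q ^ (n + 1) • Q‖ ≤ ‖Q‖ := by
      rw [norm_smul, norm_pow]
      exact mul_le_of_le_one_left (norm_nonneg _) (pow_le_one₀ (norm_nonneg _) hq1.le)
    refine mul_le_mul_of_nonneg_right (mul_le_mul (norm_qPoch_le hq1 Q n)
      ((norm_qPochInf_le hq1 _).trans ?_) (norm_nonneg _) (Real.exp_pos _).le) (norm_nonneg _)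
    exact Real.exp_le_exp.2 (div_le_div_of_nonneg_right h2 h1.le)
  have hHd : Differentiable ℂ H := by
    intro Q₀
    have h1 : 0 < 1 - ‖q‖ := by linarith
    have : DifferentiableOn ℂ H (Metric.ball 0 (‖Q₀‖ + 1)) := by
      refine Complex.differentiableOn_tsum_of_summable_norm (hδs.mul_left
        (Real.exp ((‖Q₀‖ + 1) / (1 - ‖q‖)) * Real.exp ((‖Q₀‖ + 1) / (1 - ‖q‖))))
        (fun n => ?_) Metric.isOpen_ball fun n Q hQ => (hb Q n).trans ?_
      · refine Differentiable.differentiableOn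
          (Differentiable.smul_const (Differentiable.mul ?_ ?_) _)
        · unfold qPoch; fun_prop
        · have := differentiable_qPochInf_smul hq1 (q ^ (n + 1))
          simpa only [smul_eq_mul, mul_comm] using this
      · have h3 : Real.exp (‖Q‖ / (1 - ‖q‖)) ≤ Real.exp ((‖Q₀‖ + 1) / (1 - ‖q‖)) :=
          Real.exp_le_exp.2 (div_le_div_of_nonneg_right (mem_ball_zero_iff.1 hQ).le h1.le)
        gcongr
    exact this.differentiableAt (Metric.isOpen_ball.mem_nhds (by simp))
  refine ⟨fun Q => (qPochInf Q q)⁻¹ • H Q, fun Q hQ => ?_, fun Q hQ => ?_⟩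
  · have hne := qPochInf_ne_zero_of_norm_lt_one hq1 hQ
    have hts : Summable (t Q) := (hδs.mul_left _).of_norm_bounded (hb Q)
    have hdouble : Summable fun p : ℕ × ℕ => Q ^ p.1 • ((q ^ p.1) ^ p.2 • δ p.2) := by
      refine Summable.of_norm_bounded
        ((summable_geometric_of_lt_one (norm_nonneg _) hQ).mul_of_nonneg hδs
          (fun _ => by positivity) (fun _ => by positivity)) fun p => ?_
      rw [norm_smul, norm_smul, norm_pow, norm_pow, norm_pow]
      have : (‖q‖ ^ p.1) ^ p.2 ≤ 1 :=
        pow_le_one₀ (by positivity) (pow_le_one₀ (norm_nonneg _) hq1.le)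
      gcongr
      exact mul_le_of_le_one_left (norm_nonneg _) this
    have hrow : ∀ d : ℕ, HasSum (fun n => Q ^ d • ((q ^ d) ^ n • δ n)) (Q ^ d • g (q ^ d)) :=
      fun d => (hδ _ (by rw [norm_pow]; exact pow_le_one₀ (norm_nonneg _) hq1.le)).const_smul _
    have hcol : ∀ n : ℕ, HasSum (fun d : ℕ => Q ^ d • ((q ^ d) ^ n • δ n))
        ((qPochInf Q q)⁻¹ • t Q n) := by
      intro n
      have hz : ‖q ^ n * Q‖ < 1 := by
        rw [norm_mul, norm_pow]
        exact (mul_le_of_le_one_left (norm_nonneg _)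
          (pow_le_one₀ (norm_nonneg _) hq1.le)).trans_lt hQ
      have h1 := (hasSum_geometric_of_norm_lt_one hz).smul_const (δ n)
      have h2 : (1 - q ^ n * Q)⁻¹ • δ n = (qPochInf Q q)⁻¹ • t Q n := by
        have h3 := hne
        rw [hfac Q n] at h3
        rw [ht, smul_smul, hfac Q n, mul_inv, mul_assoc, inv_mul_cancel₀ (right_ne_zero_of_mul h3),
          mul_one, smul_eq_mul]
      rw [h2] at h1
      convert h1 using 2 with d
      rw [smul_smul]
      congr 1
      ring
    have e1 := hdouble.hasSum.prod_fiberwise hrow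
    have e2 := (hdouble.prod_symm.hasSum).prod_fiberwise hcol
    rw [← (Equiv.prodComm ℕ ℕ).tsum_eq] at e1
    have e3 := e2.unique (hts.hasSum.const_smul _)
    change HasSum _ ((qPochInf Q q)⁻¹ • H Q)
    rw [hH, ← e3]
    exact e1
  · have h1 : Differentiable ℂ fun Q : ℂ => qPochInf Q q := by
      simpa using differentiable_qPochInf_smul hq1 (1 : ℂ)
    exact ((h1.analyticAt Q).inv hQ).smul (hHd.analyticAt Q)

end Continuation

/-! ### The factors of the connection formula, and a norm on `KP3` -/

/-- The function `y ↦ (q y; q)_∞^4 / ∏_{i=1}^4 (q^(i/5) y; q)_∞` whose values at `y = q^d P` are, up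
to a constant factor, the coefficients of the series at `Q = 0`. -/
def coeffFun (q r : ℂ) (y : KP3) : KP3 :=
  qPochInf (q • y) q ^ 4 * Ring.inverse (∏ i ∈ Finset.Icc 1 4, qPochInf (r ^ i • y) q)

/-- The factor `∏_{i=1}^4 (q^(i/5) P; q)_∞ / (q P; q)_∞^4` that normalizes `coeffFun` to the value
`1` at `y = P`. -/
def normConst (q r : ℂ) : KP3 :=
  (∏ i ∈ Finset.Icc 1 4, qPochInf (r ^ i • P) q) * Ring.inverse (qPochInf (q • P) q ^ 4)

/-- The theta quotient that multiplies the `j`-th solution at infinity. -/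
def thetaQuot (q r : ℂ) (j : ℕ) (Q : ℂ) : KP3 :=
  (qPochInf q q ^ 2 / (qPochInf Q q * qPochInf (q / Q) q)) •
    ((qPochInf ((r ^ j * Q) • P) q * qPochInf ((q / (r ^ j * Q)) • Pinv) q) *
      Ring.inverse (qPochInf (r ^ j • P) q * qPochInf ((q / r ^ j) • Pinv) q))

instance : Module.Finite ℂ KP3 :=
  (AdjoinRoot.powerBasis (f := ((1 - X : ℂ[X]) ^ 4)) (pow_ne_zero 4 (by
    intro h
    have := congrArg (Polynomial.eval 0) h
    simp at this))).finite

section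
attribute [local instance] Matrix.linftyOpNormedRing Matrix.linftyOpNormedAlgebra

/-- The regular representation of `KP3` by matrices. -/
def regRep : KP3 →ₐ[ℂ] Matrix (Fin (Module.finrank ℂ KP3)) (Fin (Module.finrank ℂ KP3)) ℂ :=
  Algebra.leftMulMatrix (Module.finBasis ℂ KP3)

theorem regRep_injective : Function.Injective regRep := Algebra.leftMulMatrix_injective _

instance : Nontrivial KP3 := AdjoinRoot.nontrivial _ (by
    rw [degree_pow, show (1 - X : ℂ[X]) = -(X - C 1) by simp, degree_neg, degree_X_sub_C]
    norm_num)

instance : T2Space KP3 := by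
  have : Continuous regRep := IsModuleTopology.continuous_of_linearMap regRep.toLinearMap
  exact T2Space.of_injective_continuous regRep_injective this

instance : IsTopologicalAddGroup KP3 := IsModuleTopology.topologicalAddGroup ℂ KP3

instance : ContinuousSMul ℂ KP3 := IsModuleTopology.toContinuousSMul ℂ KP3

theorem isInducing_regRep : IsInducing regRep := by
  have := LinearMap.isClosedEmbedding_of_injective (f := regRep.toLinearMap)
    (LinearMap.ker_eq_bot.2 regRep_injective)
  exact this.isInducing

/-- The operator norm of multiplication. It induces the module topology, and that topology is also
definitionally the one of the metric, so that results on normed algebras apply to `KP3` as it is. -/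
abbrev KP3.normedCommRing : NormedCommRing KP3 :=
  { NormedCommRing.induced KP3 _ regRep regRep_injective, (inferInstance : CommRing KP3) with
    toMetricSpace := (MetricSpace.induced regRep regRep_injective inferInstance).replaceTopology
      isInducing_regRep.eq_induced }

attribute [local instance] KP3.normedCommRing

theorem norm_eq_norm_regRep (x : KP3) : ‖x‖ = ‖regRep x‖ := rfl

instance : NormOneClass KP3 where
  norm_one := by
    have : Nonempty (Fin (Module.finrank ℂ KP3)) := ⟨⟨0, Module.finrank_pos⟩⟩
    rw [norm_eq_norm_regRep, map_one]
    exact (Matrix.linfty_opNorm_diagonal _).trans norm_one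

/-- `KP3` as a normed algebra, for the norm of `KP3.normedCommRing`. -/
abbrev KP3.normedAlgebra : NormedAlgebra ℂ KP3 := { (inferInstance : Algebra ℂ KP3) with
  norm_smul_le c x := by simp [norm_eq_norm_regRep, norm_smul] }

attribute [local instance] KP3.normedAlgebra

instance : CompleteSpace KP3 := FiniteDimensional.complete ℂ KP3

end

/-! ### The connection formula in the annulus `|q| < |Q| < 1` -/

section Connection

attribute [local instance] KP3.normedCommRing KP3.normedAlgebra

variable {q r : ℂ}

theorem isUnit_one_sub_smul_P {c : ℂ} (hc : c ≠ 1) : IsUnit (1 - c • P) := by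
  have h : IsNilpotent (c • (1 - P)) :=
    ⟨4, by rw [_root_.smul_pow, one_sub_P_pow_four, smul_zero]⟩
  have h2 := h.isUnit_add_left_of_commute
    ((IsUnit.mk0 (1 - c) (sub_ne_zero.2 hc.symm)).map (algebraMap ℂ KP3)) (Commute.all _ _)
  rw [Algebra.algebraMap_eq_smul_one] at h2
  convert h2 using 1
  rw [sub_smul, smul_sub, one_smul]
  abel

theorem norm_pow_mul_lt_one (hr1 : ‖r‖ < 1) (hq1 : ‖q‖ < 1) {j : ℕ} (hj : j ∈ Icc 1 4) (k : ℕ)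
    {x : ℂ} (hx : ‖x‖ < ‖r‖⁻¹) : ‖q ^ k * r ^ j * x‖ < 1 := by
  rcases eq_or_ne r 0 with rfl | hr0
  · simp at hx; exact absurd hx (norm_nonneg x).not_gt
  rw [mem_Icc] at hj
  have hr : 0 < ‖r‖ := norm_pos_iff.2 hr0
  rw [norm_mul, norm_mul, norm_pow, norm_pow]
  have h1 : ‖q‖ ^ k ≤ 1 := pow_le_one₀ (norm_nonneg _) hq1.le
  have h2 : ‖r‖ ^ j ≤ ‖r‖ := pow_le_of_le_one (norm_nonneg _) hr1.le (by omega)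
  calc ‖q‖ ^ k * ‖r‖ ^ j * ‖x‖ ≤ 1 * ‖r‖ * ‖x‖ := by gcongr
    _ < 1 * ‖r‖ * ‖r‖⁻¹ := by gcongr
    _ = 1 := by field_simp

/-- The hypothesis on poles in both expansions holds at `a = q^(j/5) P`: `P` is unipotent, and
`q^(n+j/5) ≠ 1` since `5 n + j ≠ 0`. -/
theorem isUnit_one_sub_smul_smul_P (hr0 : r ≠ 0) (hr1 : ‖r‖ < 1) (hr : r ^ 5 = q) {j : ℕ}
    (hj : j ∈ Icc 1 4) (n : ℤ) : IsUnit (1 - q ^ n • r ^ j • P) := by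
  rw [smul_smul]
  refine isUnit_one_sub_smul_P fun h => ?_
  rw [← hr, ← zpow_natCast, ← zpow_natCast r j, ← zpow_mul, ← zpow_add₀ hr0] at h
  have h2 := congrArg norm h
  rw [norm_zpow, norm_one, zpow_eq_one_iff_right₀ (norm_nonneg _) hr1.ne] at h2
  rw [mem_Icc] at hj
  push_cast at h2
  omega

theorem differentiableOn_coeffFun (hr1 : ‖r‖ < 1) (hq1 : ‖q‖ < 1) :
    DifferentiableOn ℂ (fun x : ℂ => coeffFun q r (x • P)) (Metric.ball 0 ‖r‖⁻¹) := by
  intro x hx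
  have hd : ∀ c : ℂ, DifferentiableAt ℂ (fun x : ℂ => qPochInf (c • x • P) q) x := fun c => by
    simp_rw [smul_comm c]
    exact differentiable_qPochInf_smul hq1 (c • P) x
  refine (DifferentiableAt.mul ((hd q).pow 4) ?_).differentiableWithinAt
  have hu : IsUnit (∏ i ∈ Icc 1 4, qPochInf (r ^ i • x • P) q) := by
    refine IsUnit.prod_iff.2 fun i hi => isUnit_qPochInf hq1 fun k => ?_
    rw [smul_smul, smul_smul]
    refine isUnit_one_sub_smul_P fun h => ?_
    have := norm_pow_mul_lt_one hr1 hq1 hi k (mem_ball_zero_iff.1 hx)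
    rw [h, norm_one] at this
    exact lt_irrefl _ this
  obtain ⟨u, hu⟩ := hu
  have h1 : DifferentiableAt ℂ Ring.inverse (∏ i ∈ Icc 1 4, qPochInf (r ^ i • x • P) q) := by
    rw [← hu]; exact differentiableAt_inverse u.isUnit
  exact h1.comp x (DifferentiableAt.fun_finsetProd fun i _ => hd _)

theorem seriesTerm_eq (hr0 : r ≠ 0) (hr1 : ‖r‖ < 1) (hq1 : ‖q‖ < 1) (hr : r ^ 5 = q)
    (Q : ℂ) (d : ℕ) :
    seriesTerm q r Q d = normConst q r * (Q ^ d • coeffFun q r (q ^ d • P)) := by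
  have h5 : ∀ n k : ℕ, IsUnit (1 - q ^ k • q ^ n • q • P) := fun n k => by
    rw [smul_smul, smul_smul, ← pow_add, ← pow_succ, ← hr, ← pow_mul]
    refine isUnit_one_sub_smul_P ?_
    simpa using pow_ne_pow hr0 hr1 (a := 5 * (k + n + 1)) (b := 0) (by omega)
  have hA : IsUnit (∏ i ∈ Icc 1 4, qPochInf (q ^ d • r ^ i • P) q) :=
    IsUnit.prod_iff.2 fun i hi => isUnit_qPochInf hq1 fun k => by
      rw [smul_smul (q ^ k), ← pow_add, ← zpow_natCast]
      exact isUnit_one_sub_smul_smul_P hr0 hr1 hr hi _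
  have hB : IsUnit (qPochInf (q ^ d • q • P) q) := isUnit_qPochInf hq1 (h5 d)
  rw [seriesTerm, normConst, coeffFun, mul_smul_comm]
  congr 1
  simp_rw [smul_comm _ (q ^ d)]
  rw [qPochInf_eq_qPoch_mul hq1 (q • P) d,
    prod_congr rfl fun i _ => qPochInf_eq_qPoch_mul hq1 (r ^ i • P) d, prod_mul_distrib, mul_pow,
    Ring.mul_inverse_rev]
  have e1 := Ring.mul_inverse_cancel _ hA
  have e2 := Ring.mul_inverse_cancel _ (hB.pow 4)
  linear_combination
    (-(∏ i ∈ Icc 1 4, qPoch (r ^ i • P) q d) * Ring.inverse (qPoch (q • P) q d ^ 4)) *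
    (e1 * (qPochInf (q ^ d • q • P) q ^ 4 * Ring.inverse (qPochInf (q ^ d • q • P) q ^ 4)) + e2)

/-- For `d < 0` the product `(q^(d+1) P; q)_∞^4` contains the factor `(1 - P)^4 = 0`. -/
theorem coeffFun_eq_zero (hq0 : q ≠ 0) (hq1 : ‖q‖ < 1) {d : ℤ} (hd : d < 0) :
    coeffFun q r (q ^ d • P) = 0 := by
  obtain ⟨k, hk⟩ : ∃ k : ℕ, (k : ℤ) + 1 + d = 0 := ⟨(-d - 1).toNat, by omega⟩
  have h : q ^ k • q • q ^ d • P = P := by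
    rw [smul_smul, smul_smul, ← pow_succ, ← zpow_natCast, ← zpow_add₀ hq0]
    push_cast
    rw [hk, zpow_zero, one_smul]
  rw [coeffFun, qPochInf_eq_qPoch_mul hq1 _ (k + 1), qPoch_succ, h]
  linear_combination (qPoch (q • q ^ d • P) q k * qPochInf (q ^ (k + 1) • q • q ^ d • P) q) ^ 4 *
    Ring.inverse (∏ i ∈ Icc 1 4, qPochInf (r ^ i • q ^ d • P) q) * one_sub_P_pow_four

theorem P_mul_Pinv : P * Pinv = 1 := Ring.mul_inverse_cancel _ isUnit_P

theorem smul_P_mul_smul_Pinv (hr0 : r ≠ 0) (j : ℕ) : (r ^ j • P) * ((r ^ j)⁻¹ • Pinv) = 1 := by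
  rw [smul_mul_smul_comm, P_mul_Pinv, mul_inv_cancel₀ (pow_ne_zero _ hr0), one_smul]

theorem hasSum_thetaQuot (hr0 : r ≠ 0) (hr1 : ‖r‖ < 1) (hq0 : q ≠ 0) (hq1 : ‖q‖ < 1)
    (hr : r ^ 5 = q) {j : ℕ} (hj : j ∈ Icc 1 4) {Q : ℂ} (h1 : ‖q‖ < ‖Q‖) (h2 : ‖Q‖ < 1) :
    HasSum (fun n : ℤ => Q ^ n • Ring.inverse (1 - q ^ n • r ^ j • P)) (thetaQuot q r j Q) := by
  have := hasSum_kronecker hq0 hq1 (smul_P_mul_smul_Pinv hr0 j)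
    (isUnit_one_sub_smul_smul_P hr0 hr1 hr hj) h1 h2
  have e1 : q / Q * (r ^ j)⁻¹ = q / (r ^ j * Q) := by
    rw [← div_eq_mul_inv, div_div, mul_comm Q]
  rw [smul_smul Q, smul_smul (q / Q), smul_smul q, mul_comm Q, e1, ← div_eq_mul_inv] at this
  exact this

/-- The connection formula in the annulus, for the bilateral series. The partial fractions of the
coefficients give a double series over `d` and `m`, which is a product after putting `n = d + m`. -/
theorem hasSum_coeffFun_mul_zpow (hr0 : r ≠ 0) (hr1 : ‖r‖ < 1) (hq0 : q ≠ 0) (hq1 : ‖q‖ < 1)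
    (hr : r ^ 5 = q) {Q : ℂ} (h1 : ‖q‖ < ‖Q‖) (h2 : ‖Q‖ < 1) :
    HasSum (fun d : ℤ => Q ^ d • coeffFun q r (q ^ d • P))
      (∑ j ∈ Icc 1 4, ((∑' m, (q ^ 2 / Q) ^ m * hgCoeff q r j m) * connConst q r j) •
        thetaQuot q r j Q) := by
  have hQ0 : 0 < ‖Q‖ := (norm_nonneg q).trans_lt h1
  have hQ : Q ≠ 0 := norm_pos_iff.1 hQ0
  have hz : ‖q ^ 2 / Q‖ < 1 := by
    rw [norm_div, norm_pow, div_lt_one hQ0]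
    nlinarith [norm_nonneg q]
  have hexp : ∀ d : ℤ, Q ^ d • coeffFun q r (q ^ d • P) = ∑ j ∈ Icc 1 4, ∑' m : ℕ,
      ((q ^ 2 / Q) ^ m * hgCoeff q r j m * connConst q r j) •
        (Q ^ (d + m) • Ring.inverse (1 - q ^ (d + m) • r ^ j • P)) := by
    intro d
    have e : ∀ (j m : ℕ), (r ^ j * q ^ m) • q ^ d • P = q ^ (d + m) • r ^ j • P := fun j m => by
      rw [smul_smul, smul_smul, zpow_add₀ hq0, zpow_natCast]; congr 1; ring
    rw [coeffFun, qPochInf_quotient_eq_tsum hr0 hr1 hq1 hr fun j hj m => by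
      rw [e]; exact isUnit_one_sub_smul_smul_P hr0 hr1 hr hj _, smul_sum]
    refine sum_congr rfl fun j _ => ?_
    rw [← tsum_const_smul'' (Q ^ d)]
    refine tsum_congr fun m => ?_
    rw [e, smul_smul (Q ^ d), smul_smul _ (Q ^ (d + m : ℤ))]
    congr 1
    rw [zpow_add₀ hQ, zpow_natCast, div_pow, ← pow_mul]
    field_simp
  simp_rw [hexp]
  refine hasSum_sum fun j hj => ?_
  have hc : HasSum (fun m => (q ^ 2 / Q) ^ m * hgCoeff q r j m * connConst q r j)
      ((∑' m, (q ^ 2 / Q) ^ m * hgCoeff q r j m) * connConst q r j) :=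
    (summable_hgCoeff_mul hr0 hr1 hq1 hr j hz).of_norm.hasSum.mul_right _
  have hcs : Summable fun m => ‖(q ^ 2 / Q) ^ m * hgCoeff q r j m * connConst q r j‖ := by
    simp_rw [norm_mul _ (connConst q r j)]
    exact (summable_hgCoeff_mul hr0 hr1 hq1 hr j hz).mul_right _
  have hts := summable_kronecker hq0 hq1 (smul_P_mul_smul_Pinv hr0 j)
    (isUnit_one_sub_smul_smul_P hr0 hr1 hr hj) h1 h2
  have hprod : Summable fun p : ℕ × ℤ =>
      ((q ^ 2 / Q) ^ p.1 * hgCoeff q r j p.1 * connConst q r j) •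
        (Q ^ p.2 • Ring.inverse (1 - q ^ p.2 • r ^ j • P)) := by
    refine Summable.of_norm_bounded (hcs.mul_of_nonneg hts (fun _ => norm_nonneg _)
      fun _ => norm_nonneg _) fun p => ?_
    rw [norm_smul]
  have hS := hc.smul (hasSum_thetaQuot hr0 hr1 hq0 hq1 hr hj h1 h2) hprod
  -- the substitution `n = d + m`
  let e : ℤ × ℕ ≃ ℕ × ℤ :=
    { toFun := fun p => (p.2, p.1 + p.2)
      invFun := fun p => (p.2 - p.1, p.1)
      left_inv := fun p => by simp
      right_inv := fun p => by simp }
  have hT := (e.hasSum_iff).2 hS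
  -- summation over `m` first
  refine hT.prod_fiberwise fun d => ?_
  exact (hT.summable.prod_factor d).hasSum

theorem preconnected_offSpiral (q c : ℂ) : IsPreconnected (offSpiral q c) := by
  have h : offSpiral q c = ({0} ∪ Set.range fun k : ℤ => c * q ^ k)ᶜ := by
    ext Q
    simp only [offSpiral, Set.mem_ofPred_eq, Set.mem_compl_iff, Set.mem_union,
      Set.mem_singleton_iff, Set.mem_range, not_or, not_exists]
    exact and_congr_right fun _ => forall_congr' fun k => ne_comm
  rw [h]
  have hc := (Set.countable_singleton (0 : ℂ)).union (Set.countable_range fun k : ℤ => c * q ^ k)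
  exact (hc.isPathConnected_compl_of_one_lt_rank
    (by simp [Complex.rank_real_complex])).isConnected.isPreconnected

theorem analyticAt_thetaQuot (hq1 : ‖q‖ < 1) (j : ℕ) {Q : ℂ} (hQ : Q ∈ offSpiral q 1) :
    AnalyticAt ℂ (thetaQuot q r j) Q := by
  have hdA : ∀ a : KP3, AnalyticAt ℂ (fun x : ℂ => qPochInf (x • a) q) Q := fun a =>
    (differentiable_qPochInf_smul hq1 a).analyticAt Q
  have hdA' : ∀ a : KP3, AnalyticAt ℂ (fun x : ℂ => qPochInf (x⁻¹ • a) q) Q := fun a =>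
    ((differentiable_qPochInf_smul hq1 a).analyticAt Q⁻¹).comp (f := fun x : ℂ => x⁻¹)
      (analyticAt_inv hQ.1)
  have hdC : AnalyticAt ℂ (fun x : ℂ => qPochInf x q) Q := by
    simpa using (differentiable_qPochInf_smul hq1 (1 : ℂ)).analyticAt Q
  have hdC' : AnalyticAt ℂ (fun x : ℂ => qPochInf (q / x) q) Q := by
    have := ((differentiable_qPochInf_smul hq1 q).analyticAt Q⁻¹).comp (f := fun x : ℂ => x⁻¹)
      (analyticAt_inv hQ.1)
    refine this.congr (Eventually.of_forall fun x => ?_)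
    simp [div_eq_inv_mul]
  have hne : qPochInf Q q * qPochInf (q / Q) q ≠ 0 := by
    refine mul_ne_zero (isUnit_qPochInf hq1 (isUnit_one_sub_of_mem_offSpiral hQ)).ne_zero
      (isUnit_qPochInf hq1 fun k => ?_).ne_zero
    simpa using isUnit_one_sub_div_of_mem_offSpiral hQ 1 k
  have h := (analyticAt_const (v := qPochInf q q ^ 2)).div (hdC.mul hdC') hne |>.smul
    (((hdA (r ^ j • P)).mul (hdA' ((q / r ^ j) • Pinv))).mul
      (analyticAt_const (v := Ring.inverse (qPochInf (r ^ j • P) q *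
        qPochInf ((q / r ^ j) • Pinv) q))))
  refine h.congr (Eventually.of_forall fun x => ?_)
  have e1 : x * r ^ j = r ^ j * x := mul_comm _ _
  have e2 : x⁻¹ * (q / r ^ j) = q / (r ^ j * x) := by
    rw [inv_mul_eq_div, div_div]
  simp only [thetaQuot, smul_smul, Pi.mul_apply, Pi.smul_apply', Pi.div_apply, e1, e2]

end Connection

/-! ### Continuation of the solutions at infinity, and the connection formula -/

section Connection

attribute [local instance] KP3.normedCommRing KP3.normedAlgebra

variable {q r : ℂ}

/-- The `₄φ₃` series at infinity, as a power series in `z = q^2 / Q`: its coefficients are `g (q^d)`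
up to a constant, where `g x = ∏_i (q^(1+(j-i)/5) x; q)_∞ / (q^(j/5) x; q)_∞^4`. -/
theorem exists_continuation_hgSeries (hr0 : r ≠ 0) (hr1 : ‖r‖ < 1) (hq1 : ‖q‖ < 1)
    (hr : r ^ 5 = q) {j : ℕ} (hj : j ∈ Icc 1 4) :
    ∃ V : ℂ → ℂ, (∀ z, ‖z‖ < 1 → HasSum (fun d : ℕ => z ^ d * hgCoeff q r j d) (V z)) ∧
      ∀ z, qPochInf z q ≠ 0 → AnalyticAt ℂ V z := by
  set g : ℂ → ℂ := fun x => (∏ i ∈ Icc 1 4, qPochInf (x • (q * (r ^ j / r ^ i))) q) /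
    qPochInf (x • r ^ j) q ^ 4 with hg
  set c : ℂ := qPochInf (r ^ j) q ^ 4 / ∏ i ∈ Icc 1 4, qPochInf (q * (r ^ j / r ^ i)) q with hc
  have hne : ∀ x : ℂ, ‖x‖ < ‖r‖⁻¹ → qPochInf (x • r ^ j) q ≠ 0 := fun x hx =>
    qPochInf_ne_zero_of_norm_lt_one hq1 (by
      have := norm_pow_mul_lt_one hr1 hq1 hj 0 hx
      rwa [pow_zero, one_mul, mul_comm] at this)
  have hR : 1 < ‖r‖⁻¹ := (one_lt_inv₀ (norm_pos_iff.2 hr0)).2 hr1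
  have hgd : DifferentiableOn ℂ g (Metric.ball 0 ‖r‖⁻¹) := fun x hx =>
    (DifferentiableAt.div (DifferentiableAt.fun_finsetProd fun i _ =>
      differentiable_qPochInf_smul hq1 _ x) ((differentiable_qPochInf_smul hq1 _ x).pow 4)
      (pow_ne_zero 4 (hne x (mem_ball_zero_iff.1 hx)))).differentiableWithinAt
  have hcoeff : ∀ d, hgCoeff q r j d = c * g (q ^ d) := by
    intro d
    have hqd : ‖q ^ d‖ < ‖r‖⁻¹ := by
      rw [norm_pow]; exact (pow_le_one₀ (norm_nonneg _) hq1.le).trans_lt hR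
    have h1 := hne _ hqd
    have h2 : ∏ i ∈ Icc 1 4, qPochInf (q ^ d • (q * (r ^ j / r ^ i))) q ≠ 0 :=
      prod_ne_zero_iff.2 fun i hi => (isUnit_qPochInf hq1 fun k => by
        rw [smul_smul, ← pow_add]
        exact isUnit_one_sub_lower hr0 hr1 hr hi _).ne_zero
    rw [hgCoeff, hc, hg, qPochInf_eq_qPoch_mul hq1 (r ^ j) d,
      prod_congr rfl fun i _ => qPochInf_eq_qPoch_mul hq1 (q * (r ^ j / r ^ i)) d,
      prod_mul_distrib, mul_pow, div_mul_div_comm, mul_right_comm,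
      mul_assoc (∏ i ∈ Icc 1 4, qPoch _ _ _),
      mul_assoc, mul_div_mul_right _ _ (mul_ne_zero h2 (pow_ne_zero 4 h1))]
  obtain ⟨G, hG1, hG2⟩ := exists_analytic_continuation hq1 hR hgd
  refine ⟨fun z => c * G z, fun z hz => ?_, fun z hz => analyticAt_const.mul (hG2 z hz)⟩
  refine ((hG1 z hz).mul_left c).congr_fun fun d => ?_
  rw [hcoeff, smul_eq_mul]
  ring

theorem inv_mem_offSpiral {c Q : ℂ} (hQ : Q ∈ offSpiral q (-c)) (hc : c ≠ 0) :
    c * Q⁻¹ ∈ offSpiral q (-1) := by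
  refine ⟨mul_ne_zero hc (inv_ne_zero hQ.1), fun k h => hQ.2 (-k) ?_⟩
  have h2 : c = -1 * q ^ k * Q := by
    rw [← h, inv_mul_cancel_right₀ hQ.1]
  have h3 : q ^ k ≠ 0 := by rintro h0; rw [h0] at h2; simp at h2; exact hc h2
  rw [zpow_neg, h2]
  field_simp

/-- The series at `0` and at `∞`, freed from their constant factors and from `e_{q,λ}`, continue
analytically, and the continuations satisfy the connection formula. -/
theorem exists_connection (hr0 : r ≠ 0) (hr1 : ‖r‖ < 1) (hq0 : q ≠ 0) (hq1 : ‖q‖ < 1)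
    (hr : r ^ 5 = q) :
    ∃ (G : ℂ → KP3) (V : ℕ → ℂ → ℂ),
      (∀ Q, ‖Q‖ < 1 → HasSum (seriesTerm q r Q) (normConst q r * G Q)) ∧
      (∀ φ : KP3 →ₗ[ℂ] ℂ, ∀ Q ∈ offSpiral q 1, AnalyticAt ℂ (fun Q => φ (normConst q r * G Q)) Q) ∧
      (∀ j ∈ Icc 1 4, ∀ z, ‖z‖ < 1 → HasSum (fun d : ℕ => z ^ d * hgCoeff q r j d) (V j z)) ∧
      (∀ j ∈ Icc 1 4, ∀ Q ∈ offSpiral q 1, AnalyticAt ℂ (fun Q => V j (q ^ 2 / Q)) Q) ∧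
      ∀ Q ∈ offSpiral q 1, G Q = ∑ j ∈ Icc 1 4,
        thetaQuot q r j Q * algebraMap ℂ KP3 (connConst q r j * V j (q ^ 2 / Q)) := by
  have hR : 1 < ‖r‖⁻¹ := (one_lt_inv₀ (norm_pos_iff.2 hr0)).2 hr1
  obtain ⟨G, hG1, hG2⟩ := exists_analytic_continuation hq1 hR (differentiableOn_coeffFun hr1 hq1)
  have hV : ∀ j : ℕ, ∃ V : ℂ → ℂ, j ∈ Icc 1 4 →
      (∀ z, ‖z‖ < 1 → HasSum (fun d : ℕ => z ^ d * hgCoeff q r j d) (V z)) ∧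
      ∀ z, qPochInf z q ≠ 0 → AnalyticAt ℂ V z := fun j => by
    by_cases hj : j ∈ Icc 1 4
    · obtain ⟨V, hV⟩ := exists_continuation_hgSeries hr0 hr1 hq1 hr hj
      exact ⟨V, fun _ => hV⟩
    · exact ⟨0, fun h => absurd h hj⟩
  choose V hV using hV
  have hGan : ∀ Q ∈ offSpiral q 1, AnalyticAt ℂ G Q := fun Q hQ =>
    hG2 Q (isUnit_qPochInf hq1 (isUnit_one_sub_of_mem_offSpiral hQ)).ne_zero
  have hVan : ∀ j ∈ Icc 1 4, ∀ Q ∈ offSpiral q 1, AnalyticAt ℂ (fun Q => V j (q ^ 2 / Q)) Q :=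
    fun j hj Q hQ => ((hV j hj).2 (q ^ 2 / Q)
      (isUnit_qPochInf hq1 (isUnit_one_sub_div_of_mem_offSpiral hQ 2)).ne_zero).comp
      (f := fun Q : ℂ => q ^ 2 / Q) (analyticAt_const.div analyticAt_id hQ.1)
  -- the connection formula for the continuations, by the identity theorem from the annulus
  have hconn : Set.EqOn G (fun Q => ∑ j ∈ Icc 1 4,
      (V j (q ^ 2 / Q) * connConst q r j) • thetaQuot q r j Q) (offSpiral q 1) := by
    -- the real base point `ρ` lies in the annulus, and off the spiral as `|q| < ρ < |q|^0`
    obtain ⟨ρ, hρ1, hρ2⟩ := exists_between hq1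
    have hρ0 : 0 ≤ ρ := (norm_nonneg q).trans hρ1.le
    have hann : ∀ Q : ℂ, ‖q‖ < ‖Q‖ → ‖Q‖ < 1 → G Q = ∑ j ∈ Icc 1 4,
        (V j (q ^ 2 / Q) * connConst q r j) • thetaQuot q r j Q := by
      intro Q h1 h2
      have hz : ‖q ^ 2 / Q‖ < 1 := by
        rw [norm_div, norm_pow, div_lt_one ((norm_nonneg q).trans_lt h1)]
        nlinarith [norm_nonneg q]
      have h3 := hasSum_coeffFun_mul_zpow hr0 hr1 hq0 hq1 hr h1 h2
      rw [← Nat.cast_injective.hasSum_iff] at h3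
      · rw [sum_congr rfl fun j hj => by rw [((hV j hj).1 _ hz).tsum_eq]] at h3
        refine (hG1 Q h2).unique (h3.congr_fun fun d => ?_)
        simp only [Function.comp_apply, zpow_natCast]
      · intro d hd
        rw [coeffFun_eq_zero hq0 hq1, smul_zero]
        by_contra h
        exact hd ⟨d.toNat, Int.toNat_of_nonneg (not_lt.1 h)⟩
    have hmem : (ρ : ℂ) ∈ offSpiral q 1 := by
      refine ⟨fun h => ?_, fun k h => ?_⟩
      · rw [Complex.ofReal_eq_zero] at h
        exact (norm_nonneg q).not_gt (h ▸ hρ1)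
      · have h2 := congrArg norm h
        rw [one_mul, norm_zpow, Complex.norm_real, Real.norm_of_nonneg hρ0] at h2
        have hq : 0 < ‖q‖ := norm_pos_iff.2 hq0
        rw [h2] at hρ1 hρ2
        nth_rw 1 [← zpow_one ‖q‖] at hρ1
        rw [← zpow_zero ‖q‖] at hρ2
        rw [zpow_lt_zpow_iff_right_of_lt_one₀ hq hq1] at hρ1 hρ2
        omega
    refine AnalyticOnNhd.eqOn_of_preconnected_of_eventuallyEq (𝕜 := ℂ) (z₀ := (ρ : ℂ))
      hGan (fun Q hQ => ?_) (preconnected_offSpiral q 1) hmem ?_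
    · exact analyticAt_fun_sum _ fun j hj =>
        ((hVan j hj Q hQ).mul analyticAt_const).smul (analyticAt_thetaQuot hq1 j hQ)
    · have hnorm : ‖(ρ : ℂ)‖ = ρ := by rw [Complex.norm_real, Real.norm_of_nonneg hρ0]
      have ho : IsOpen {Q : ℂ | ‖q‖ < ‖Q‖ ∧ ‖Q‖ < 1} :=
        (isOpen_lt continuous_const continuous_norm).inter
          (isOpen_lt continuous_norm continuous_const)
      filter_upwards [ho.mem_nhds ⟨by rwa [hnorm], by rwa [hnorm]⟩] with Q hQ
      exact hann Q hQ.1 hQ.2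
  refine ⟨G, V, fun Q hQ => ?_, fun φ Q hQ => ?_, fun j hj => (hV j hj).1, hVan, fun Q hQ => ?_⟩
  · exact ((hG1 Q hQ).mul_left (normConst q r)).congr_fun (seriesTerm_eq hr0 hr1 hq1 hr Q)
  · exact (φ.toContinuousLinearMap.analyticAt _).comp (analyticAt_const.mul (hGan Q hQ))
  · rw [hconn hQ]
    refine sum_congr rfl fun j _ => ?_
    rw [Algebra.smul_def, mul_comm, mul_comm (V j _)]

end Connection
end QDiff

end

open QDiff
theorem mainTheorem4 (q r : ℂ) (hq0 : q ≠ 0) (hq1 : ‖q‖ < 1) (hr : r ^ 5 = q) :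
    ∃ (F : ℂ → KP3) (W : ℕ → ℂ → ℂ),
      -- `F` is the analytic continuation of the series at `Q = 0`
      (∀ Q : ℂ, ‖Q‖ < 1 → HasSum (seriesTerm q r Q) (F Q)) ∧
      (∀ φ : KP3 →ₗ[ℂ] ℂ, AnalyticOnNhd ℂ (fun Q => φ (F Q)) (offSpiral q 1)) ∧
      -- `W j` is the analytic continuation of the solution `W_j(1/Q)` at `Q = ∞`
      (∀ j ∈ Finset.Icc 1 4, ∀ Q ∈ offSpiral q (-(r ^ j)), ‖q‖ ^ 2 < ‖Q‖ →
        HasSum (solTerm q r j Q) (W j Q)) ∧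
      (∀ j ∈ Finset.Icc 1 4,
        AnalyticOnNhd ℂ (W j) (offSpiral q 1 ∩ offSpiral q (-(r ^ j)))) ∧
      -- the connection formula, at every `Q` that is not a pole of one of the factors
      ∀ Q : ℂ, Q ∈ offSpiral q 1 → Q ∈ offSpiral q (-1) →
        (∀ j ∈ Finset.Icc 1 4, Q ∈ offSpiral q (-(r ^ j))) →
        Ppow (qLog q Q) * F Q =
          Ppow (qLog q Q) *
            ((∏ i ∈ Finset.Icc 1 4, qPochInf (r ^ i • P) q) *
              Ring.inverse (qPochInf (q • P) q ^ 4)) *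
            ∑ j ∈ Finset.Icc 1 4,
              (qPochInf q q ^ 2 / (qPochInf Q q * qPochInf (q / Q) q)) •
              ((qPochInf ((r ^ j * Q) • P) q * qPochInf ((q / (r ^ j * Q)) • Pinv) q) *
                Ring.inverse (qPochInf (r ^ j • P) q * qPochInf ((q / r ^ j) • Pinv) q)) *
              algebraMap ℂ KP3
                (qPochInf (q / r ^ j) q ^ 4 * (qChar q (r ^ j) Q⁻¹)⁻¹ /
                    ((∏ i ∈ (Finset.Icc 1 4).erase j, qPochInf (r ^ i / r ^ j) q) *
                      qPochInf q q) *
                  W j Q) := by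
  have hr0 : r ≠ 0 := by rintro rfl; exact hq0 (by rw [← hr]; norm_num)
  have hr1 : ‖r‖ < 1 := by
    rw [← hr, norm_pow] at hq1
    exact lt_of_not_ge fun h => absurd hq1 (one_le_pow₀ h).not_gt
  obtain ⟨G, V, hG, hGan, hV, hVan, hconn⟩ := exists_connection hr0 hr1 hq0 hq1 hr
  have hth : ∀ c Q : ℂ, c ≠ 0 → Q ∈ offSpiral q (-c) → theta q (c * Q⁻¹) ≠ 0 := fun c Q hc hQ =>
    theta_ne_zero hq0 hq1 (inv_mem_offSpiral hQ hc)
  refine ⟨fun Q => normConst q r * G Q, fun j Q => qChar q (r ^ j) Q⁻¹ * V j (q ^ 2 / Q),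
    hG, hGan, fun j hj Q hQ hQ2 => ?_, fun j hj Q hQ => ?_,
    fun Q hQ hQ1 hQj => ?_⟩
  · have hz : ‖q ^ 2 / Q‖ < 1 := by
      rw [norm_div, norm_pow]
      exact (div_lt_one (norm_pos_iff.2 hQ.1)).2 hQ2
    refine ((hV j hj _ hz).mul_left _).congr_fun fun d => ?_
    rw [solTerm, hgCoeff]
    ring
  · have hQ0 : Q ≠ 0 := hQ.1.1
    have hrj := pow_ne_zero j hr0
    refine AnalyticAt.mul (AnalyticAt.div ?_ ?_ (hth _ Q hrj hQ.2)) (hVan j hj Q hQ.1)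
    · exact (analyticAt_theta hq0 hq1 (inv_ne_zero hQ0)).comp (f := fun x : ℂ => x⁻¹)
        (analyticAt_inv hQ0)
    · exact (analyticAt_theta hq0 hq1 (mul_ne_zero hrj (inv_ne_zero hQ0))).comp
        (f := fun x : ℂ => r ^ j * x⁻¹) (analyticAt_const.mul (analyticAt_inv hQ0))
  · rw [mul_assoc]
    refine congrArg (fun x => Ppow (qLog q Q) * (normConst q r * x)) ((hconn Q hQ).trans ?_)
    refine Finset.sum_congr rfl fun j hj => ?_
    have h1 : qChar q (r ^ j) Q⁻¹ ≠ 0 := by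
      refine div_ne_zero ?_ (hth _ Q (pow_ne_zero j hr0) (hQj j hj))
      simpa using hth 1 Q one_ne_zero hQ1
    refine congrArg (fun x => thetaQuot q r j Q * algebraMap ℂ KP3 x) ?_
    rw [connConst]
    beta_reduce
    generalize qChar q (r ^ j) Q⁻¹ = e at h1 ⊢
    field_simp
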